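/- Let $\mathbf{X}$ be a finitely supported real random variable with $\mathbb{E}[\mathbf{X}]=0$ and $\mathrm{Var}[\mathbf{X}]=1$. There exists a constant $C=C_{\mathbf{X}}>0$, depending only on the distribution of $\mathbf{X}$, such that the following holds for all integers $n\ge 0$ and $d\ge 1$. Let $f(x_1,\dots,x_n)$ be a real multilinear polynomial (degree at most one in each variable) of total degree at most $d$, let $\mathbf{X}^{\otimes n}$ denote the law on $\mathbb{R}^n$ of $n$ independent copies of $\mathbf{X}$, and for $i\in[n]$ let $$\mathrm{Inf}_i[f]:=\mathbb{E}_{x\sim \mathbf{X}^{\otimes n}}\left[\left(\frac{\partial f}{\partial x_i}(x)\right)^2\right].$$ Suppose that $\mathrm{Var}_{x\sim \mathbf{X}^{\otimes n}}[f(x)]=1$, that $t\ge 1$ is real, and that $$\mathrm{Inf}_i[f]\le t^{-2}C^{-d}\quad\text{for all } i\in[n].$$ Then $$\Pr_{x\sim \mathbf{X}^{\otimes n}}\big[|f(x)|\ge t\big]\ \ge\ \exp\!\big(-C\,t^2 d^2\log(\max\{d,2\})\big).$$ In particular, for $d\ge 2$ the right-hand side is $\exp(-C\,t^2d^2\log d)$.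 -/

import Mathlib

open MeasureTheory ProbabilityTheory

/-- A measure on `ℝ` (the law of a real random variable) is finitely supported if it is
concentrated on a finite set of points. -/
def FinitelySupported (μ : Measure ℝ) : Prop :=
  ∃ s : Finset ℝ, μ ((s : Set ℝ)ᶜ) = 0

/-- The product law on `ℝⁿ`: the law of `n` independent draws from `μ`. -/
noncomputable def productLaw (μ : Measure ℝ) (n : ℕ) : Measure (Fin n → ℝ) :=
  Measure.pi fun _ => μ

/-- A polynomial in `n` variables is multilinear if its degree in each variable is at most one. -/
def IsMultilinear {n : ℕ} (f : MvPolynomial (Fin n) ℝ) : Prop :=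
  ∀ i, f.degreeOf i ≤ 1

/-- The influence of coordinate `i` on `f`: the expected square of the partial derivative
`∂f/∂xᵢ` at a random point whose coordinates are independent draws from `μ`. -/
noncomputable def influence {n : ℕ} (μ : Measure ℝ) (f : MvPolynomial (Fin n) ℝ) (i : Fin n) : ℝ :=
  ∫ x, (MvPolynomial.eval x (MvPolynomial.pderiv i f)) ^ 2 ∂(productLaw μ n)

/-! Write f = ∑ c_S ∏_{i ∈ S} x_i. Since X is standardised, Parseval turns the variance into ∑_{S ≠
∅} c_S² and the influence of i into ∑_{S ∋ i} c_S². The lower tail bound comes from tilting the law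
so that f has mean of size 2t, and then paying for the change of measure.

A linear function would respond directly to a tilt of the means, so a large degree one part is
produced first. Include each coordinate in a random set J with probability about 1/|S|: then |S ∩ J|
= 1 with probability at least 1/8. Pigeonholing over the dyadic scales of |S| gives a fixed J with σ
= ∑_{|S ∩ J| = 1} c_S² at least of order 1/log d (`exists_restriction`). Freeze the coordinates
outside J at a random z. The degree one coefficient at i ∈ J is a polynomial a_i(z) of degree at
most d, and the expectation of ∑ a_i² is σ. Hypercontractivity (`prodExp_multilin_fourth_le`), small
influences and Paley–Zygmund show that the coefficients of size at most η already give ∑ a_i² ≥ σ/4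
with probability exponentially small only in d (`le_prob_sum_trunc_sq`).

For such z, let β be proportional to the truncated a_i and give coordinate i ∈ J the density 1 + ρ
β_i x_i, which has mean ρ β_i; truncation keeps this density positive. The tilted mean of f is a
polynomial P(ρ) of degree at most d whose linear coefficient is at least 3td. The higher degree
parts cannot cancel it for every ρ: Bernstein's inequality at 0 (`Polynomial.abs_coeff_one_le`)
yields ρ ∈ [-1, 1] with |P(ρ)| ≥ 2t. Hypercontractivity under the tilted law then gives |f| ≥ t with
tilted probability exponentially small only in d. Cauchy–Schwarz returns to the original law at cost
exp(∑ β_i²), where ∑ β_i² is of order t²d²/σ, hence at most of order t²d² log d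
(`le_prodExp_condWeight`).

Expectations are finite sums whose weights may depend on the coordinate, so that original, frozen
and tilted laws are treated alike. -/

/-! ### Bernstein's inequality at the origin. -/

/-- The odd part of a polynomial is `x R(x²)`. -/
lemma Polynomial.exists_odd_part (P : Polynomial ℝ) {d : ℕ} (hd : P.natDegree ≤ d) (hd1 : 1 ≤ d) :
    ∃ R : Polynomial ℝ, R.eval 0 = P.coeff 1 ∧ 2 * R.natDegree + 1 ≤ d ∧
      ∀ x : ℝ, P.eval x - P.eval (-x) = 2 * (x * R.eval (x ^ 2)) := by
  set R := Polynomial.contract 2 P.divX with hR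
  have hdec : P = Polynomial.expand ℝ 2 (Polynomial.contract 2 P)
      + Polynomial.X * Polynomial.expand ℝ 2 R := by
    ext k
    rw [Polynomial.coeff_add]
    rcases Nat.even_or_odd' k with ⟨m, rfl | rfl⟩
    · have h2 : (Polynomial.X * Polynomial.expand ℝ 2 R).coeff (2 * m) = 0 := by
        rcases m with _ | m
        · simp
        · rw [show 2 * (m + 1) = (2 * m + 1) + 1 by ring, Polynomial.coeff_X_mul,
            Polynomial.coeff_expand (by norm_num), if_neg (by omega)]
      rw [h2, add_zero, Polynomial.coeff_expand (by norm_num), if_pos (by simp),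
        Polynomial.coeff_contract (by norm_num)]
      congr 1; omega
    · rw [Polynomial.coeff_X_mul, Polynomial.coeff_expand (by norm_num), if_neg (by omega),
        Polynomial.coeff_expand (by norm_num), if_pos (by simp), hR,
        Polynomial.coeff_contract (by norm_num), Polynomial.coeff_divX, zero_add]
      congr 1; omega
  refine ⟨R, ?_, ?_, fun x => ?_⟩
  · rw [← Polynomial.coeff_zero_eq_eval_zero, hR, Polynomial.coeff_contract (by norm_num),
      Polynomial.coeff_divX]
  · have : R.natDegree ≤ (d - 1) / 2 := by
      rw [Polynomial.natDegree_le_iff_coeff_eq_zero]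
      intro N hN
      rw [hR, Polynomial.coeff_contract (by norm_num), Polynomial.coeff_divX]
      exact Polynomial.coeff_eq_zero_of_natDegree_lt (by omega)
    omega
  · have h : ∀ y : ℝ, P.eval y = (Polynomial.contract 2 P).eval (y ^ 2) + y * R.eval (y ^ 2) := by
      intro y
      conv_lhs => rw [hdec]
      simp [Polynomial.expand_eval]
    rw [h x, h (-x)]; ring_nf

/-- Bernstein's inequality at the centre of the interval `[-1, 1]`. -/
theorem Polynomial.abs_coeff_one_le (P : Polynomial ℝ) {d : ℕ} (hd : P.natDegree ≤ d) {M : ℝ}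
    (hM : 0 < M) (hP : ∀ x ∈ Set.Icc (-1 : ℝ) 1, |P.eval x| ≤ M) : |P.coeff 1| ≤ d * M := by
  rcases Nat.eq_zero_or_pos d with rfl | hd1
  · rw [Polynomial.coeff_eq_zero_of_natDegree_lt (by omega)]; simp
  obtain ⟨R, hR0, hRd, hR⟩ := P.exists_odd_part hd hd1
  have hodd : ∀ x ∈ Set.Icc (-1 : ℝ) 1, |x * R.eval (x ^ 2)| ≤ M := by
    intro x hx
    have h1 := abs_le.1 (hP x hx)
    have h2 := abs_le.1 (hP (-x) ⟨by linarith [hx.2], by linarith [hx.1]⟩)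
    have := hR x
    rw [abs_le]; constructor <;> linarith
  set g : Polynomial ℝ := Polynomial.X * R ^ 2
  set q : Polynomial ℝ := Polynomial.C (1 / 2) * (1 - Polynomial.X)
  -- With s = (1 - u)/2 and x = √s, the square of the odd part is s R(s)², a polynomial in u of
  -- degree at most d with values in [0, M²]. `H` rescales it to [-1, 1], and the point x = 0
  -- becomes the endpoint u = 1.
  set H : Polynomial ℝ := 1 - Polynomial.C (2 / M ^ 2) * g.comp q
  have hq : q.natDegree ≤ 1 := by
    refine (Polynomial.natDegree_C_mul_le _ _).trans ((Polynomial.natDegree_sub_le _ _).trans ?_)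
    simp
  have hg : g.natDegree ≤ d := by
    refine Polynomial.natDegree_mul_le.trans ?_
    have := Polynomial.natDegree_pow_le (p := R) (n := 2)
    have hX : (Polynomial.X : Polynomial ℝ).natDegree = 1 := Polynomial.natDegree_X
    omega
  have hH : H.natDegree ≤ d := by
    refine (Polynomial.natDegree_sub_le _ _).trans (max_le (by simp) ?_)
    refine (Polynomial.natDegree_C_mul_le _ _).trans (Polynomial.natDegree_comp_le.trans ?_)
    calc g.natDegree * q.natDegree ≤ d * 1 := Nat.mul_le_mul hg hq
      _ = d := mul_one d
  have hbd : ∀ u ∈ Set.Icc (-1 : ℝ) 1, |H.eval u| ≤ 1 := by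
    intro u hu
    set s := (1 - u) / 2 with hs
    have hs0 : 0 ≤ s := by rw [hs]; linarith [hu.2]
    have hs1 : s ≤ 1 := by rw [hs]; linarith [hu.1]
    have hx : Real.sqrt s ∈ Set.Icc (-1 : ℝ) 1 :=
      ⟨by linarith [Real.sqrt_nonneg s], Real.sqrt_le_one.2 hs1⟩
    have h1 := hodd _ hx
    rw [Real.sq_sqrt hs0] at h1
    have h2 : s * R.eval s ^ 2 ≤ M ^ 2 := by
      have := sq_le_sq' (abs_le.1 h1).1 (abs_le.1 h1).2
      rwa [mul_pow, Real.sq_sqrt hs0] at this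
    have hHu : H.eval u = 1 - 2 * ((s * R.eval s ^ 2) / M ^ 2) := by
      have hqs : q.eval u = s := by simp [q, hs]; ring
      simp only [H, g, Polynomial.eval_sub, Polynomial.eval_one, Polynomial.eval_mul,
        Polynomial.eval_C, Polynomial.eval_comp, Polynomial.eval_X, Polynomial.eval_pow, hqs]
      ring
    have h3 : (s * R.eval s ^ 2) / M ^ 2 ≤ 1 := (div_le_one (by positivity)).2 h2
    have h4 : 0 ≤ (s * R.eval s ^ 2) / M ^ 2 := by positivity
    rw [hHu, abs_le]; constructor <;> linarith
  -- Chebyshev extremality at the endpoint: H'(1) ≤ T_d'(1) = d², while H'(1) = R(0)²/M².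
  have hmain := Polynomial.Chebyshev.eval_iterate_derivative_le_of_forall_abs_le_one (k := 1)
    (le_refl (1 : ℝ)) (Polynomial.degree_le_of_natDegree_le hH) hbd
  have hder : (Polynomial.derivative H).eval 1 = P.coeff 1 ^ 2 / M ^ 2 := by
    have hq1 : q.eval 1 = 0 := by simp [q]
    simp only [H, g, Polynomial.derivative_sub, Polynomial.derivative_one,
      Polynomial.derivative_mul, Polynomial.derivative_C, Polynomial.derivative_comp,
      Polynomial.derivative_X, Polynomial.eval_sub, Polynomial.eval_mul, Polynomial.eval_add,
      Polynomial.eval_comp, Polynomial.eval_X, Polynomial.eval_one, Polynomial.eval_zero,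
      Polynomial.eval_pow, Polynomial.eval_C, hq1, hR0, q]
    ring
  simp only [Function.iterate_one] at hmain
  rw [hder, Polynomial.Chebyshev.derivative_T_eval_one, div_le_iff₀ (by positivity)] at hmain
  refine abs_le_of_sq_le_sq ?_ (by positivity)
  push_cast at hmain
  linarith [mul_pow (d : ℝ) M 2]

/-! ### Finite product expectations and hypercontractivity. -/

/-- Expectation of `F` when the coordinates are independent and coordinate `i` has law `w i`. -/
noncomputable def prodExp {ι α : Type*} [Fintype ι] [DecidableEq ι] [Fintype α]
    (w : ι → α → ℝ) (F : (ι → α) → ℝ) : ℝ :=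
  ∑ x, (∏ i, w i (x i)) * F x

/-- Each `w i` is a probability vector. -/
structure IsWeight {ι α : Type*} [Fintype α] (w : ι → α → ℝ) : Prop where
  nonneg : ∀ i a, 0 ≤ w i a
  sum_one : ∀ i, ∑ a, w i a = 1

/-- The multilinear polynomial with coefficients `c S`, `S ⊆ U`, in the variables `v (x i)`. -/
noncomputable def multilin {ι α : Type*} (v : α → ℝ) (U : Finset ι) (c : Finset ι → ℝ)
    (x : ι → α) : ℝ :=
  ∑ S ∈ U.powerset, c S * ∏ i ∈ S, v (x i)

section

variable {ι α : Type*}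

lemma multilin_add_mul (v : α → ℝ) (U : Finset ι) (c c' : Finset ι → ℝ) (m : ℝ) (x : ι → α) :
    multilin v U (fun S => c S + m * c' S) x = multilin v U c x + m * multilin v U c' x := by
  simp only [multilin, Finset.mul_sum, ← Finset.sum_add_distrib]
  exact Finset.sum_congr rfl fun S _ => by ring

lemma multilin_eq_zero (v : α → ℝ) {U : Finset ι} {c : Finset ι → ℝ} (hc : ∀ S ⊆ U, c S = 0)
    (x : ι → α) : multilin v U c x = 0 :=
  Finset.sum_eq_zero fun S hS => by rw [hc S (Finset.mem_powerset.1 hS), zero_mul]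

variable [DecidableEq ι]

lemma multilin_insert (v : α → ℝ) {i : ι} {U : Finset ι} (hi : i ∉ U) (c : Finset ι → ℝ)
    (x : ι → α) : multilin v (insert i U) c x
      = multilin v U c x + v (x i) * multilin v U (fun S => c (insert i S)) x := by
  rw [multilin, Finset.sum_powerset_insert hi, multilin, multilin, Finset.mul_sum]
  congr 1
  refine Finset.sum_congr rfl fun S hS => ?_
  rw [Finset.prod_insert fun h => hi (Finset.mem_powerset.1 hS h)]
  ring

lemma multilin_update (v : α → ℝ) {i : ι} {U : Finset ι} (hi : i ∉ U) (c : Finset ι → ℝ)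
    (x : ι → α) (a : α) : multilin v U c (Function.update x i a) = multilin v U c x := by
  refine Finset.sum_congr rfl fun S hS => ?_
  congr 1
  refine Finset.prod_congr rfl fun j hj => ?_
  rw [Function.update_of_ne]
  rintro rfl
  exact hi (Finset.mem_powerset.1 hS hj)

/-- Splitting off a centred coordinate. -/
lemma multilin_insert_center (v : α → ℝ) {i : ι} {U : Finset ι} (hi : i ∉ U) (c : Finset ι → ℝ)
    (m : ℝ) (x : ι → α) : multilin v (insert i U) c x
      = multilin v U (fun S => c S + m * c (insert i S)) x
        + (v (x i) - m) * multilin v U (fun S => c (insert i S)) x := by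
  rw [multilin_insert v hi, multilin_add_mul]
  ring

end

/-- Centring a coordinate. -/
lemma sum_weight_sub_mean {ι α : Type*} [Fintype α] {w : ι → α → ℝ} (hw : IsWeight w) (v : α → ℝ) (i : ι) :
    ∑ a, w i a * (v a - ∑ b, w i b * v b) = 0 := by
  simp only [mul_sub, Finset.sum_sub_distrib, ← Finset.sum_mul, hw.sum_one]
  ring

section

variable {ι α : Type*} [Fintype ι] [DecidableEq ι] [Fintype α] {w : ι → α → ℝ}

lemma prodExp_add (F G : (ι → α) → ℝ) :
    prodExp w (fun x => F x + G x) = prodExp w F + prodExp w G := by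
  simp only [prodExp, mul_add, Finset.sum_add_distrib]

lemma prodExp_const_mul (r : ℝ) (F : (ι → α) → ℝ) :
    prodExp w (fun x => r * F x) = r * prodExp w F := by
  simp only [prodExp, Finset.mul_sum]
  exact Finset.sum_congr rfl fun x _ => by ring

lemma prodExp_sum {κ : Type*} (s : Finset κ) (F : κ → (ι → α) → ℝ) :
    prodExp w (fun x => ∑ k ∈ s, F k x) = ∑ k ∈ s, prodExp w (F k) := by
  simp only [prodExp, Finset.mul_sum]
  exact Finset.sum_comm

lemma prodExp_mono (hw : IsWeight w) {F G : (ι → α) → ℝ} (h : ∀ x, F x ≤ G x) :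
    prodExp w F ≤ prodExp w G :=
  Finset.sum_le_sum fun x _ =>
    mul_le_mul_of_nonneg_left (h x) (Finset.prod_nonneg fun i _ => hw.nonneg i _)

lemma prodExp_nonneg (hw : IsWeight w) {F : (ι → α) → ℝ} (h : ∀ x, 0 ≤ F x) :
    0 ≤ prodExp w F :=
  Finset.sum_nonneg fun x _ => mul_nonneg (Finset.prod_nonneg fun i _ => hw.nonneg i _) (h x)

lemma prodExp_prod (φ : ι → α → ℝ) :
    prodExp w (fun x => ∏ i, φ i (x i)) = ∏ i, ∑ a, w i a * φ i a := by
  rw [Fintype.prod_sum]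
  simp only [prodExp, Finset.prod_mul_distrib]

lemma prodExp_const (hw : IsWeight w) (r : ℝ) : prodExp w (fun _ => r) = r := by
  have h := prodExp_prod (w := w) fun _ _ => 1
  simp only [Finset.prod_const_one, mul_one, hw.sum_one] at h
  have h2 := prodExp_const_mul (w := w) r fun _ => 1
  rw [h] at h2
  simpa using h2

lemma sq_prodExp_mul_le (hw : IsWeight w) (F G : (ι → α) → ℝ) :
    prodExp w (fun x => F x * G x) ^ 2
      ≤ prodExp w (fun x => F x ^ 2) * prodExp w (fun x => G x ^ 2) := by
  have h0 : ∀ x : ι → α, 0 ≤ ∏ i, w i (x i) := fun x =>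
    Finset.prod_nonneg fun i _ => hw.nonneg i _
  exact Finset.sum_sq_le_sum_mul_sum_of_sq_le_mul _
    (fun x _ => mul_nonneg (h0 x) (sq_nonneg _)) (fun x _ => mul_nonneg (h0 x) (sq_nonneg _))
    (fun x _ => le_of_eq (by ring))

/-- Resampling one coordinate does not change the expectation. -/
lemma prodExp_update (hw : IsWeight w) (i : ι) (F : (ι → α) → ℝ) :
    prodExp w (fun x => ∑ a, w i a * F (Function.update x i a)) = prodExp w F := by
  -- Swapping coordinate `i` with the fresh sample is an involution that preserves the joint weight.
  have hinv : Function.Involutive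
      (fun q : (ι → α) × α => (Function.update q.1 i q.2, q.1 i)) := by
    rintro ⟨x, a⟩
    simp
  have key : ∀ (x : ι → α) (a : α), (∏ j, w j (Function.update x i a j)) * w i (x i)
      = (∏ j, w j (x j)) * w i a := by
    intro x a
    rw [← Finset.mul_prod_erase _ _ (Finset.mem_univ i),
      ← Finset.mul_prod_erase _ (fun j => w j (x j)) (Finset.mem_univ i)]
    have : ∏ j ∈ Finset.univ.erase i, w j (Function.update x i a j)
        = ∏ j ∈ Finset.univ.erase i, w j (x j) :=
      Finset.prod_congr rfl fun j hj => by
        rw [Function.update_of_ne (Finset.ne_of_mem_erase hj)]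
    rw [this, Function.update_self]
    ring
  calc prodExp w (fun x => ∑ a, w i a * F (Function.update x i a))
      = ∑ q : (ι → α) × α, ((∏ j, w j (q.1 j)) * w i q.2) * F (Function.update q.1 i q.2) := by
        simp only [prodExp, Fintype.sum_prod_type, Finset.mul_sum, mul_assoc]
    _ = ∑ q : (ι → α) × α, ((∏ j, w j (q.1 j)) * w i q.2) * F q.1 := by
        rw [← Equiv.sum_comp hinv.toPerm]
        refine Finset.sum_congr rfl fun q _ => ?_
        obtain ⟨x, a⟩ := q
        simp [key]
    _ = prodExp w F := by
        simp only [prodExp, Fintype.sum_prod_type]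
        refine Finset.sum_congr rfl fun x _ => ?_
        simp only [mul_right_comm _ _ (F x)]
        rw [← Finset.mul_sum, hw.sum_one, mul_one]

/-- Independence of one coordinate from a function of the others. -/
lemma prodExp_coord_mul (hw : IsWeight w) {i : ι} (φ : α → ℝ) {G : (ι → α) → ℝ}
    (hG : ∀ x a, G (Function.update x i a) = G x) :
    prodExp w (fun x => φ (x i) * G x) = (∑ a, w i a * φ a) * prodExp w G := by
  rw [← prodExp_update hw i, ← prodExp_const_mul]
  congr 1
  ext x
  simp only [Function.update_self, hG, Finset.sum_mul, mul_assoc]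

/-- Fourth moment recursion for `g + (φ - E φ) h`. -/
lemma prodExp_fourth_step (hw : IsWeight w) {i : ι} (φ : α → ℝ) {g h : (ι → α) → ℝ}
    (hφ : ∑ a, w i a * φ a = 0)
    (hg : ∀ x a, g (Function.update x i a) = g x) (hh : ∀ x a, h (Function.update x i a) = h x) :
    prodExp w (fun x => (g x + φ (x i) * h x) ^ 4) ≤ prodExp w (fun x => g x ^ 4)
      + 8 * ((∑ a, w i a * φ a ^ 2) * prodExp w (fun x => g x ^ 2 * h x ^ 2))
      + 3 * ((∑ a, w i a * φ a ^ 4) * prodExp w (fun x => h x ^ 4)) := by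
  have h1 : prodExp w (fun x => φ (x i) * (g x ^ 3 * h x)) = 0 := by
    rw [prodExp_coord_mul hw φ (G := fun x => g x ^ 3 * h x) fun x a => by simp only [hg, hh], hφ,
      zero_mul]
  rw [← prodExp_coord_mul hw (fun a => φ a ^ 2) (G := fun x => g x ^ 2 * h x ^ 2)
      fun x a => by simp only [hg, hh],
    ← prodExp_coord_mul hw (fun a => φ a ^ 4) (G := fun x => h x ^ 4) fun x a => by simp only [hh]]
  calc prodExp w (fun x => (g x + φ (x i) * h x) ^ 4)
      ≤ prodExp w (fun x => ((g x ^ 4 + 4 * (φ (x i) * (g x ^ 3 * h x)))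
          + 8 * (φ (x i) ^ 2 * (g x ^ 2 * h x ^ 2))) + 3 * (φ (x i) ^ 4 * h x ^ 4)) :=
        prodExp_mono hw fun x => by
          -- Only the cubic cross term needs an estimate: 4φ³gh³ ≤ 2φ²g²h² + 2φ⁴h⁴. This raises the
          -- binomial coefficients 6 and 1 to 8 and 3.
          nlinarith [sq_nonneg (φ (x i) * g x * h x - φ (x i) ^ 2 * h x ^ 2)]
    _ = _ := by
        rw [prodExp_add, prodExp_add, prodExp_add, prodExp_const_mul, prodExp_const_mul,
          prodExp_const_mul, h1]
        ring

lemma prodExp_sq_step (hw : IsWeight w) {i : ι} (φ : α → ℝ) {g h : (ι → α) → ℝ}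
    (hφ : ∑ a, w i a * φ a = 0)
    (hg : ∀ x a, g (Function.update x i a) = g x) (hh : ∀ x a, h (Function.update x i a) = h x) :
    prodExp w (fun x => (g x + φ (x i) * h x) ^ 2) = prodExp w (fun x => g x ^ 2)
      + (∑ a, w i a * φ a ^ 2) * prodExp w (fun x => h x ^ 2) := by
  have h1 : prodExp w (fun x => φ (x i) * (g x * h x)) = 0 := by
    rw [prodExp_coord_mul hw φ (G := fun x => g x * h x) fun x a => by simp only [hg, hh], hφ,
      zero_mul]
  rw [← prodExp_coord_mul hw (fun a => φ a ^ 2) (G := fun x => h x ^ 2)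
    fun x a => by simp only [hh]]
  calc prodExp w (fun x => (g x + φ (x i) * h x) ^ 2)
      = prodExp w (fun x => (g x ^ 2 + 2 * (φ (x i) * (g x * h x))) + φ (x i) ^ 2 * h x ^ 2) := by
        congr 1; ext x; ring
    _ = _ := by rw [prodExp_add, prodExp_add, prodExp_const_mul, h1]; ring

/-- Bonami's lemma: `(4, 2)`-hypercontractivity for multilinear polynomials of independent
variables whose centred fourth moments are controlled by their variances. -/
theorem prodExp_multilin_fourth_le (hw : IsWeight w) (v : α → ℝ) {L B : ℝ} (hL : 4 ≤ L)
    (hB0 : 0 ≤ B) (hB : 3 * B ≤ L ^ 2)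
    (hmom : ∀ i, ∑ a, w i a * (v a - ∑ b, w i b * v b) ^ 4
      ≤ B * (∑ a, w i a * (v a - ∑ b, w i b * v b) ^ 2) ^ 2)
    (U : Finset ι) (d : ℕ) (c : Finset ι → ℝ) (hc : ∀ S ⊆ U, d < S.card → c S = 0) :
    prodExp w (fun x => multilin v U c x ^ 4)
      ≤ L ^ (2 * d) * prodExp w (fun x => multilin v U c x ^ 2) ^ 2 := by
  induction U using Finset.induction_on generalizing d c with
  | empty =>
    have h : ∀ x : ι → α, multilin v ∅ c x = c ∅ := fun x => by simp [multilin]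
    simp only [h, prodExp_const hw]
    have : (1 : ℝ) ≤ L ^ (2 * d) := one_le_pow₀ (by linarith)
    nlinarith [sq_nonneg (c ∅ ^ 2)]
  | insert i U hi ih =>
    set m := ∑ b, w i b * v b with hm
    set c' : Finset ι → ℝ := fun S => c (insert i S) with hc'
    have hcard : ∀ S ⊆ U, (insert i S).card = S.card + 1 := fun S hS =>
      Finset.card_insert_of_notMem fun h => hi (hS h)
    have hg := ih d (fun S => c S + m * c' S) (fun S hS hd => by
      rw [hc S (hS.trans (Finset.subset_insert _ _)) hd,
        show c' S = 0 from hc _ (Finset.insert_subset_insert _ hS) (by rw [hcard S hS]; omega)]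
      ring)
    have e4 : ∀ x, multilin v (insert i U) c x ^ 4 = (multilin v U (fun S => c S + m * c' S) x
        + (v (x i) - m) * multilin v U c' x) ^ 4 := fun x => by
      rw [multilin_insert_center v hi c m]
    have e2 : ∀ x, multilin v (insert i U) c x ^ 2 = (multilin v U (fun S => c S + m * c' S) x
        + (v (x i) - m) * multilin v U c' x) ^ 2 := fun x => by
      rw [multilin_insert_center v hi c m]
    simp only [e4, e2]
    have h4 := prodExp_fourth_step hw (i := i) (fun a => v a - m)
      (sum_weight_sub_mean hw v i)
      (fun x a => multilin_update v hi (fun S => c S + m * c' S) x a)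
      (fun x a => multilin_update v hi c' x a)
    have h2 := prodExp_sq_step hw (i := i) (fun a => v a - m)
      (sum_weight_sub_mean hw v i)
      (fun x a => multilin_update v hi (fun S => c S + m * c' S) x a)
      (fun x a => multilin_update v hi c' x a)
    rcases d with _ | d
    · have h0 : ∀ x : ι → α, multilin v U c' x = 0 := multilin_eq_zero v fun S hS =>
        hc _ (Finset.insert_subset_insert _ hS) (by rw [hcard S hS]; omega)
      simpa [h0] using hg
    have hh := ih d c' (fun S hS hd => hc _ (Finset.insert_subset_insert _ hS)
      (by rw [hcard S hS]; omega))
    rw [h2]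
    refine h4.trans ?_
    have hcs := sq_prodExp_mul_le hw (fun x => multilin v U (fun S => c S + m * c' S) x ^ 2)
      (fun x => multilin v U c' x ^ 2)
    simp only [← pow_mul] at hcs
    have hs4 := hmom i
    rw [← hm] at hs4
    have hG := prodExp_nonneg hw fun x => sq_nonneg (multilin v U (fun S => c S + m * c' S) x)
    have hH := prodExp_nonneg hw fun x => sq_nonneg (multilin v U c' x)
    have hH4 := prodExp_nonneg hw fun x => by
      have := (show Even 4 by decide).pow_nonneg (multilin v U c' x)
      exact this
    have hs : 0 ≤ ∑ a, w i a * (v a - m) ^ 2 :=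
      Finset.sum_nonneg fun a _ => mul_nonneg (hw.nonneg i a) (sq_nonneg _)
    generalize prodExp w (fun x => multilin v U (fun S => c S + m * c' S) x ^ 4) = G4 at *
    generalize prodExp w (fun x => multilin v U (fun S => c S + m * c' S) x ^ 2) = G at *
    generalize prodExp w (fun x => multilin v U c' x ^ 4) = H4 at *
    generalize prodExp w (fun x => multilin v U c' x ^ 2) = H at *
    generalize prodExp w (fun x => multilin v U (fun S => c S + m * c' S) x ^ 2
      * multilin v U c' x ^ 2) = GH at *
    generalize (∑ a, w i a * (v a - m) ^ 2) = s at *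
    generalize (∑ a, w i a * (v a - m) ^ 4) = s4 at *
    have hLd : 0 < L ^ d := by positivity
    -- The polynomial g has degree at most d + 1 but h only d, so Cauchy–Schwarz gives the
    -- intermediate power L^(2d+1). The missing factor L absorbs the constant 8 through 8 ≤ 2L.
    have hGH : GH ≤ L * (L ^ d) ^ 2 * (G * H) := by
      refine le_trans (le_abs_self _) (abs_le_of_sq_le_sq ?_ (by positivity))
      calc GH ^ 2 ≤ G4 * H4 := hcs
        _ ≤ (L ^ (2 * (d + 1)) * G ^ 2) * (L ^ (2 * d) * H ^ 2) := by gcongr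
        _ = _ := by ring
    have t1 : s * GH ≤ s * (L * (L ^ d) ^ 2 * (G * H)) := by gcongr
    have t2 : s4 * H4 ≤ (B * s ^ 2) * (L ^ (2 * d) * H ^ 2) := by
      have hBs : 0 ≤ B * s ^ 2 := by positivity
      gcongr
    have t3 : 3 * (B * s ^ 2 * (L ^ (2 * d) * H ^ 2)) ≤ L ^ 2 * (s ^ 2 * (L ^ (2 * d) * H ^ 2)) := by
      have : 0 ≤ s ^ 2 * (L ^ (2 * d) * H ^ 2) := by positivity
      nlinarith
    have t4 : 8 * (s * (L * (L ^ d) ^ 2 * (G * H))) ≤ 2 * (L ^ 2 * (s * ((L ^ d) ^ 2 * (G * H)))) := by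
      have : 0 ≤ s * ((L ^ d) ^ 2 * (G * H)) * L := by positivity
      nlinarith
    calc G4 + 8 * (s * GH) + 3 * (s4 * H4)
        ≤ L ^ (2 * (d + 1)) * G ^ 2 + 2 * (L ^ 2 * (s * ((L ^ d) ^ 2 * (G * H))))
          + L ^ 2 * (s ^ 2 * (L ^ (2 * d) * H ^ 2)) := by linarith
      _ = L ^ (2 * (d + 1)) * (G + s * H) ^ 2 := by ring

end

/-! ### Parseval, Paley–Zygmund and change of measure. -/

section

variable {ι α : Type*} [Fintype ι] [DecidableEq ι] [Fintype α] {w : ι → α → ℝ}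

/-- Parseval's identity for multilinear polynomials of standardised variables. -/
lemma prodExp_multilin_sq (hw : IsWeight w) (v : α → ℝ) (hmean : ∀ i, ∑ a, w i a * v a = 0)
    (hvar : ∀ i, ∑ a, w i a * v a ^ 2 = 1) (U : Finset ι) (c : Finset ι → ℝ) :
    prodExp w (fun x => multilin v U c x ^ 2) = ∑ S ∈ U.powerset, c S ^ 2 := by
  induction U using Finset.induction_on generalizing c with
  | empty => simp [multilin, prodExp_const hw]
  | insert i U hi ih =>
    rw [Finset.sum_powerset_insert hi, ← ih, ← ih fun S => c (insert i S)]
    simp only [multilin_insert v hi]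
    rw [prodExp_sq_step hw v (hmean i) (fun x a => multilin_update v hi c x a)
      (fun x a => multilin_update v hi _ x a), hvar, one_mul]

/-- By independence a multilinear polynomial may be evaluated at the means. This is what makes the
tilted expectation a polynomial in the tilt parameter. -/
lemma prodExp_multilin (hw : IsWeight w) (v : α → ℝ) (U : Finset ι) (c : Finset ι → ℝ) :
    prodExp w (multilin v U c) = ∑ S ∈ U.powerset, c S * ∏ i ∈ S, ∑ a, w i a * v a := by
  induction U using Finset.induction_on generalizing c with
  | empty =>
    rw [show multilin v ∅ c = fun _ : ι → α => c ∅ from funext fun x => by simp [multilin]]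
    simp [prodExp_const hw]
  | insert i U hi ih =>
    have h : multilin v (insert i U) c = fun x : ι → α =>
        multilin v U c x + v (x i) * multilin v U (fun S => c (insert i S)) x :=
      funext fun x => multilin_insert v hi c x
    rw [h, prodExp_add, prodExp_coord_mul hw v (fun x a => multilin_update v hi _ x a),
      Finset.sum_powerset_insert hi, ← ih, ih fun S => c (insert i S), Finset.mul_sum]
    congr 1
    refine Finset.sum_congr rfl fun S hS => ?_
    rw [Finset.prod_insert fun h => hi (Finset.mem_powerset.1 hS h)]
    ring

/-- The Paley–Zygmund inequality. -/
lemma paley_zygmund (hw : IsWeight w) {F : (ι → α) → ℝ} {s : ℝ} (hs : 0 ≤ s)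
    (hm : 2 * s ≤ prodExp w F) :
    s ^ 2 ≤ prodExp w (fun x => F x ^ 2) * prodExp w (Set.indicator {x | s ≤ F x} 1) := by
  set I : (ι → α) → ℝ := Set.indicator {x | s ≤ F x} 1 with hI
  have hI2 : ∀ x, I x ^ 2 = I x := fun x => by
    by_cases h : s ≤ F x <;> simp [hI, h]
  have h1 : prodExp w F ≤ s + prodExp w (fun x => F x * I x) := by
    refine le_trans ?_ ((prodExp_add (w := w) (fun _ => s) (fun x => F x * I x)).trans_le
      (by rw [prodExp_const hw]))
    refine prodExp_mono hw fun x => ?_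
    by_cases h : s ≤ F x
    · have : I x = 1 := by simp [hI, h]
      rw [this]; linarith
    · have : I x = 0 := by simp [hI, h]
      rw [this]; linarith
  have h2 := sq_prodExp_mul_le hw F I
  simp only [hI2] at h2
  have h3 : s ≤ prodExp w (fun x => F x * I x) := by linarith
  calc s ^ 2 ≤ prodExp w (fun x => F x * I x) ^ 2 := by gcongr
    _ ≤ _ := h2

/-- A function whose fourth moment is controlled by its second moment is at least half its mean
with substantial probability. -/
lemma prob_ge_of_fourth_le (hw : IsWeight w) {F : (ι → α) → ℝ} {K t : ℝ} (hK : 0 < K)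
    (h4 : prodExp w (fun x => F x ^ 4) ≤ K * prodExp w (fun x => F x ^ 2) ^ 2) (ht : 0 < t)
    (hm : 2 * t ≤ |prodExp w F|) :
    1 / (4 * K) ≤ prodExp w (Set.indicator {x | t ≤ |F x|} 1) := by
  set m := prodExp w (fun x => |F x|) with hmdef
  set Q := prodExp w (fun x => F x ^ 2) with hQdef
  have hmF : |prodExp w F| ≤ m := by
    rw [abs_le]
    constructor
    · have : prodExp w (fun x => (-1) * |F x|) ≤ prodExp w F :=
        prodExp_mono hw fun x => by linarith [neg_abs_le (F x)]
      rw [prodExp_const_mul] at this; linarith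
    · exact prodExp_mono hw fun x => le_abs_self _
  have hmpos : 0 < m := by linarith
  -- Log-convexity of moments: Q² ≤ mT and T² ≤ Q E[F⁴] ≤ K Q³, where T is the third absolute
  -- moment. Eliminating T bounds the second moment by the first.
  have hQm : Q ≤ K * m ^ 2 := by
    set T := prodExp w (fun x => |F x| ^ 3)
    have hT : 0 ≤ T := prodExp_nonneg hw fun x => by positivity
    have hQ0 : 0 ≤ Q := prodExp_nonneg hw fun x => sq_nonneg _
    have c1 : Q ^ 2 ≤ m * T := by
      have := sq_prodExp_mul_le hw (fun x => Real.sqrt |F x|) (fun x => Real.sqrt |F x| * |F x|)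
      have e1 : ∀ x, Real.sqrt |F x| * (Real.sqrt |F x| * |F x|) = F x ^ 2 := fun x => by
        rw [← mul_assoc, Real.mul_self_sqrt (abs_nonneg _), ← sq, sq_abs]
      have e2 : ∀ x, Real.sqrt |F x| ^ 2 = |F x| := fun x => Real.sq_sqrt (abs_nonneg _)
      have e3 : ∀ x, (Real.sqrt |F x| * |F x|) ^ 2 = |F x| ^ 3 := fun x => by
        rw [mul_pow, e2]; ring
      simpa only [e1, e2, e3] using this
    have c2 : T ^ 2 ≤ Q * (K * Q ^ 2) := by
      have := sq_prodExp_mul_le hw (fun x => |F x|) (fun x => F x ^ 2)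
      have e1 : ∀ x, |F x| * F x ^ 2 = |F x| ^ 3 := fun x => by rw [← sq_abs (F x)]; ring
      have e2 : ∀ x, (F x ^ 2) ^ 2 = F x ^ 4 := fun x => by ring
      simp only [e1, e2, sq_abs] at this
      exact this.trans (mul_le_mul_of_nonneg_left h4 hQ0)
    rcases hQ0.eq_or_lt with h0 | hQpos
    · rw [← h0]; positivity
    have c3 : Q ^ 3 * Q ≤ Q ^ 3 * (K * m ^ 2) := by
      calc Q ^ 3 * Q = (Q ^ 2) ^ 2 := by ring
        _ ≤ (m * T) ^ 2 := by gcongr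
        _ = m ^ 2 * T ^ 2 := by ring
        _ ≤ m ^ 2 * (Q * (K * Q ^ 2)) := by gcongr
        _ = _ := by ring
    exact le_of_mul_le_mul_left c3 (by positivity)
  have hpz := paley_zygmund hw (F := fun x => |F x|) (s := m / 2)
    (by positivity) (by rw [← hmdef]; linarith)
  simp only [sq_abs] at hpz
  have hsub : prodExp w (Set.indicator {x | m / 2 ≤ |F x|} 1)
      ≤ prodExp w (Set.indicator {x | t ≤ |F x|} 1) :=
    prodExp_mono hw fun x => Set.indicator_le_indicator_of_subset
      (fun y hy => by simp only [Set.mem_ofPred_eq] at hy ⊢; linarith) (fun _ => zero_le_one) x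
  set P := prodExp w (Set.indicator {x | t ≤ |F x|} 1)
  have hP0 : 0 ≤ prodExp w (Set.indicator {x | m / 2 ≤ |F x|} 1) :=
    prodExp_nonneg hw fun x => Set.indicator_nonneg (fun _ _ => zero_le_one) x
  have hfin : m ^ 2 * 1 ≤ m ^ 2 * (P * (4 * K)) := by
    have : (m / 2) ^ 2 ≤ (K * m ^ 2) * P := hpz.trans (by gcongr)
    nlinarith
  rw [div_le_iff₀ (by positivity)]
  exact le_of_mul_le_mul_left hfin (by positivity)

/-- Change of measure by the Cauchy–Schwarz inequality. -/
lemma sq_prodExp_tilt_indicator_le (hw : IsWeight w) (r : ι → α → ℝ) (A : Set (ι → α)) :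
    prodExp (fun i a => w i a * r i a) (Set.indicator A 1) ^ 2
      ≤ (∏ i, ∑ a, w i a * r i a ^ 2) * prodExp w (Set.indicator A 1) := by
  have h := sq_prodExp_mul_le hw (fun x => ∏ i, r i (x i)) (Set.indicator A 1)
  have e1 : prodExp (fun i a => w i a * r i a) (Set.indicator A 1)
      = prodExp w (fun x => (∏ i, r i (x i)) * Set.indicator A 1 x) := by
    simp only [prodExp, Finset.prod_mul_distrib, mul_assoc]
  have e2 : ∀ x, Set.indicator A (1 : (ι → α) → ℝ) x ^ 2 = Set.indicator A 1 x := fun x => by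
    by_cases hx : x ∈ A <;> simp [hx]
  have e3 : prodExp w (fun x => (∏ i, r i (x i)) ^ 2) = ∏ i, ∑ a, w i a * r i a ^ 2 := by
    rw [← prodExp_prod (fun i a => r i a ^ 2)]
    simp only [Finset.prod_pow]
  rw [e1]
  simp only [e2, e3] at h
  exact h

end

/-! ### Freezing coordinates and tilting the rest. -/

/-- Coordinates in `J` have law `p`, the others are frozen at `z`. -/
noncomputable def condWeight {ι α : Type*} [DecidableEq ι] [DecidableEq α] (p : α → ℝ)
    (J : Finset ι) (z : ι → α) (i : ι) (a : α) : ℝ :=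
  if i ∈ J then p a else if a = z i then 1 else 0

section

variable {ι α : Type*} [DecidableEq ι] [Fintype α] [DecidableEq α]

lemma isWeight_condWeight {p : α → ℝ} (hp : ∀ a, 0 ≤ p a) (hp1 : ∑ a, p a = 1) (J : Finset ι)
    (z : ι → α) : IsWeight (condWeight p J z) where
  nonneg i a := by
    unfold condWeight
    split_ifs
    exacts [hp a, zero_le_one, le_rfl]
  sum_one i := by
    unfold condWeight
    split_ifs
    exacts [hp1, by simp]

/-- The tilted law `(1 + γ v) p` on `J` has mean `γ`. -/
lemma sum_tilt_mul {p v : α → ℝ} (hmean : ∑ a, p a * v a = 0) (hvar : ∑ a, p a * v a ^ 2 = 1)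
    {J : Finset ι} (z : ι → α) {γ : ι → ℝ} (hγ : ∀ i ∉ J, γ i = 0) (i : ι) :
    ∑ a, condWeight p J z i a * (1 + γ i * v a) * v a = if i ∈ J then γ i else v (z i) := by
  unfold condWeight
  split_ifs with h
  · calc ∑ a, p a * (1 + γ i * v a) * v a = ∑ a, p a * v a + γ i * ∑ a, p a * v a ^ 2 := by
          rw [Finset.mul_sum, ← Finset.sum_add_distrib]
          exact Finset.sum_congr rfl fun a _ => by ring
      _ = γ i := by rw [hmean, hvar]; ring
  · simp [hγ i h]

/-- This is the per-coordinate cost of the change of measure. It is quadratic in γ because the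
linear term vanishes with the mean. -/
lemma sum_tilt_sq {p v : α → ℝ} (hp1 : ∑ a, p a = 1) (hmean : ∑ a, p a * v a = 0)
    (hvar : ∑ a, p a * v a ^ 2 = 1)
    {J : Finset ι} (z : ι → α) {γ : ι → ℝ} (hγ : ∀ i ∉ J, γ i = 0) (i : ι) :
    ∑ a, condWeight p J z i a * (1 + γ i * v a) ^ 2 = 1 + γ i ^ 2 := by
  unfold condWeight
  split_ifs with h
  · calc ∑ a, p a * (1 + γ i * v a) ^ 2
        = ∑ a, p a + 2 * γ i * ∑ a, p a * v a + γ i ^ 2 * ∑ a, p a * v a ^ 2 := by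
          rw [Finset.mul_sum, Finset.mul_sum, ← Finset.sum_add_distrib, ← Finset.sum_add_distrib]
          exact Finset.sum_congr rfl fun a _ => by ring
      _ = _ := by rw [hp1, hmean, hvar]; ring
  · simp [hγ i h]

/-- The bound on |γ_i| R keeps the density 1 + γ_i v at least 1/2, and centring preserves the total
mass. -/
lemma isWeight_tilt {p v : α → ℝ} (hp : ∀ a, 0 ≤ p a) (hp1 : ∑ a, p a = 1)
    (hmean : ∑ a, p a * v a = 0) {R : ℝ} (hR : ∀ a, |v a| ≤ R)
    {J : Finset ι} (z : ι → α) {γ : ι → ℝ} (hγ : ∀ i ∉ J, γ i = 0)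
    (hγR : ∀ i, |γ i| * R ≤ 1 / 2) :
    IsWeight (fun i a => condWeight p J z i a * (1 + γ i * v a)) where
  nonneg i a := by
    refine mul_nonneg ((isWeight_condWeight hp hp1 J z).nonneg i a) ?_
    have h : |γ i * v a| ≤ 1 / 2 := by
      rw [abs_mul]
      exact (mul_le_mul_of_nonneg_left (hR a) (abs_nonneg _)).trans (hγR i)
    linarith [(abs_le.1 h).1]
  sum_one i := by
    unfold condWeight
    split_ifs with h
    · calc ∑ a, p a * (1 + γ i * v a) = ∑ a, p a + γ i * ∑ a, p a * v a := by
            rw [Finset.mul_sum, ← Finset.sum_add_distrib]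
            exact Finset.sum_congr rfl fun a _ => by ring
        _ = 1 := by rw [hp1, hmean]; ring
    · simp [hγ i h]

/-- Deviations on `J` are at most 2R, so the fourth central moment is at most 4R² times the variance
s. The density is at least 1/2, so s ≥ 1/2 and s ≤ 2s². A frozen coordinate is a point mass, with
both central moments zero. -/
lemma tilt_fourth_le {p v : α → ℝ} (hp : ∀ a, 0 ≤ p a) (hp1 : ∑ a, p a = 1)
    (hmean : ∑ a, p a * v a = 0) (hvar : ∑ a, p a * v a ^ 2 = 1) {R : ℝ} (hR1 : 1 ≤ R)
    (hR : ∀ a, |v a| ≤ R) {J : Finset ι} (z : ι → α) {γ : ι → ℝ} (hγ : ∀ i ∉ J, γ i = 0)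
    (hγR : ∀ i, |γ i| * R ≤ 1 / 2) (i : ι) :
    ∑ a, condWeight p J z i a * (1 + γ i * v a)
        * (v a - ∑ b, condWeight p J z i b * (1 + γ i * v b) * v b) ^ 4
      ≤ 8 * R ^ 2 * (∑ a, condWeight p J z i a * (1 + γ i * v a)
        * (v a - ∑ b, condWeight p J z i b * (1 + γ i * v b) * v b) ^ 2) ^ 2 := by
  rw [sum_tilt_mul hmean hvar z hγ i]
  by_cases h : i ∈ J
  · have hw := isWeight_tilt hp hp1 hmean hR z hγ hγR
    simp only [if_pos h]
    set W : α → ℝ := fun a => condWeight p J z i a * (1 + γ i * v a) with hW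
    have hW0 : ∀ a, 0 ≤ W a := fun a => hw.nonneg i a
    have hWp : ∀ a, p a / 2 ≤ W a := fun a => by
      have h1 : |γ i * v a| ≤ 1 / 2 := by
        rw [abs_mul]
        exact (mul_le_mul_of_nonneg_left (hR a) (abs_nonneg _)).trans (hγR i)
      have : W a = p a * (1 + γ i * v a) := by simp [hW, condWeight, h]
      rw [this]
      nlinarith [hp a, (abs_le.1 h1).1]
    have hγ1 : |γ i| ≤ R := by nlinarith [hγR i, abs_nonneg (γ i)]
    set s := ∑ a, W a * (v a - γ i) ^ 2 with hs
    have hs2 : 1 / 2 ≤ s := by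
      calc (1 : ℝ) / 2 ≤ (1 + γ i ^ 2) / 2 := by nlinarith [sq_nonneg (γ i)]
        _ = (∑ a, p a * v a ^ 2 - 2 * γ i * ∑ a, p a * v a + γ i ^ 2 * ∑ a, p a) / 2 := by
          rw [hvar, hmean, hp1]; ring
        _ = ∑ a, p a / 2 * (v a - γ i) ^ 2 := by
          rw [Finset.mul_sum, Finset.mul_sum, ← Finset.sum_sub_distrib, ← Finset.sum_add_distrib,
            Finset.sum_div]
          exact Finset.sum_congr rfl fun a _ => by ring
        _ ≤ s := Finset.sum_le_sum fun a _ => mul_le_mul_of_nonneg_right (hWp a) (sq_nonneg _)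
    have h4 : ∑ a, W a * (v a - γ i) ^ 4 ≤ 4 * R ^ 2 * s := by
      rw [hs, Finset.mul_sum]
      refine Finset.sum_le_sum fun a _ => ?_
      have hb : (v a - γ i) ^ 2 ≤ 4 * R ^ 2 := by
        have : |v a - γ i| ≤ 2 * R := (abs_sub _ _).trans (by linarith [hR a])
        have := sq_le_sq' (abs_le.1 this).1 (abs_le.1 this).2
        linarith
      calc W a * (v a - γ i) ^ 4 = W a * (v a - γ i) ^ 2 * (v a - γ i) ^ 2 := by ring
        _ ≤ W a * (v a - γ i) ^ 2 * (4 * R ^ 2) :=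
          mul_le_mul_of_nonneg_left hb (mul_nonneg (hW0 a) (sq_nonneg _))
        _ = _ := by ring
    refine h4.trans ?_
    have : s ≤ 2 * s ^ 2 := by nlinarith
    nlinarith [sq_nonneg R]
  · simp [condWeight, h]

/-- Freezing the coordinates outside `J` at a random point and drawing the others afresh does not
change the expectation. -/
lemma prodExp_condWeight [Fintype ι] {p : α → ℝ} (hp1 : ∑ a, p a = 1) (J : Finset ι)
    (F : (ι → α) → ℝ) :
    prodExp (fun _ : ι => p) (fun z => prodExp (condWeight p J z) F) = prodExp (fun _ => p) F := by
  -- For fixed x, averaging over z replaces each frozen factor by the probability that z_i = x_i,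
  -- which is p(x_i).
  have h : ∀ x : ι → α, prodExp (fun _ : ι => p) (fun z => ∏ i, condWeight p J z i (x i))
      = ∏ i, p (x i) := fun x => by
    have := prodExp_prod (w := fun _ : ι => p)
      (fun i b => if i ∈ J then p (x i) else if x i = b then 1 else 0)
    refine this.trans (Finset.prod_congr rfl fun i _ => ?_)
    split_ifs
    · rw [← Finset.sum_mul, hp1, one_mul]
    · simp
  conv_rhs => rw [prodExp]
  simp only [← h]
  conv_lhs => rw [show (fun z => prodExp (condWeight p J z) F)
    = fun z => ∑ x, F x * ∏ i, condWeight p J z i (x i) from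
      funext fun z => Finset.sum_congr rfl fun x _ => mul_comm _ _]
  rw [prodExp_sum]
  refine Finset.sum_congr rfl fun x _ => ?_
  rw [prodExp_const_mul, mul_comm]

end

section

variable {ι α : Type*} [Fintype ι] [DecidableEq ι] [Fintype α] [DecidableEq α]

/-- If the degree one part of `f(z, ·)` is large at `β`, then `|f|` is large with substantial
probability over the coordinates in `J`. -/
theorem le_prodExp_condWeight {p v : α → ℝ} (hp : ∀ a, 0 ≤ p a) (hp1 : ∑ a, p a = 1)
    (hmean : ∑ a, p a * v a = 0) (hvar : ∑ a, p a * v a ^ 2 = 1) {R : ℝ} (hR1 : 1 ≤ R)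
    (hR : ∀ a, |v a| ≤ R) {J : Finset ι} (z : ι → α) {β : ι → ℝ} (hβ : ∀ i ∉ J, β i = 0)
    (hβR : ∀ i, |β i| * R ≤ 1 / 2) {d : ℕ} (hd : 1 ≤ d) {c : Finset ι → ℝ}
    (hc : ∀ S, d < S.card → c S = 0) {t : ℝ} (ht : 0 < t)
    (hlin : 3 * t * d ≤ ∑ S, if (S ∩ J).card = 1 then
      c S * ((∏ i ∈ S ∩ J, β i) * ∏ i ∈ S \ J, v (z i)) else 0) :
    Real.exp (-∑ i, β i ^ 2) / (16 * (5 * R) ^ (4 * d)) ≤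
      prodExp (condWeight p J z)
        (Set.indicator {x | t ≤ |multilin v Finset.univ c x|} 1) := by
  -- `P` evaluated at ρ is the mean of f when the coordinates in `J` have means ρ β_i and the others
  -- are frozen at z.
  set P : Polynomial ℝ := ∑ S, Polynomial.monomial (S ∩ J).card
    (c S * ((∏ i ∈ S ∩ J, β i) * ∏ i ∈ S \ J, v (z i))) with hP
  have hPdeg : P.natDegree ≤ d := by
    refine Polynomial.natDegree_sum_le_of_forall_le _ _ fun S _ => ?_
    by_cases hS : d < S.card
    · simp [hc S hS]
    · exact (Polynomial.natDegree_monomial_le _).trans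
        ((Finset.card_le_card Finset.inter_subset_left).trans (not_lt.1 hS))
  have hP1 : 3 * t * d ≤ P.coeff 1 := by
    refine hlin.trans (le_of_eq ?_)
    rw [hP, Polynomial.finsetSum_coeff]
    exact Finset.sum_congr rfl fun S _ => by rw [Polynomial.coeff_monomial]
  have hd0 : (0 : ℝ) < d := by exact_mod_cast hd
  -- If |P| stayed below 2t on [-1, 1], Bernstein would bound the linear coefficient by 2td,
  -- contradicting 3td.
  obtain ⟨ρ, hρ, hPρ⟩ : ∃ ρ ∈ Set.Icc (-1 : ℝ) 1, 2 * t ≤ |P.eval ρ| := by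
    by_contra! hcon
    have h := P.abs_coeff_one_le hPdeg (M := 2 * t) (by positivity) fun x hx => (hcon x hx).le
    have := (le_abs_self _).trans h
    nlinarith [mul_pos ht hd0]
  have hρ1 : |ρ| ≤ 1 := abs_le.2 hρ
  have hγ : ∀ i ∉ J, ρ * β i = 0 := fun i hi => by rw [hβ i hi, mul_zero]
  have hγR : ∀ i, |ρ * β i| * R ≤ 1 / 2 := fun i => by
    rw [abs_mul, mul_assoc]
    have h0 : 0 ≤ |β i| * R := by positivity
    exact (mul_le_of_le_one_left h0 hρ1).trans (hβR i)
  have hw := isWeight_condWeight hp hp1 J z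
  have hw' := isWeight_tilt hp hp1 hmean hR z hγ hγR
  have hyp := prodExp_multilin_fourth_le hw' v (L := 5 * R) (B := 8 * R ^ 2) (by linarith)
    (by positivity) (by nlinarith) (tilt_fourth_le hp hp1 hmean hvar hR1 hR z hγ hγR)
    Finset.univ d c fun S _ => hc S
  have hEf : prodExp (fun i a => condWeight p J z i a * (1 + ρ * β i * v a))
      (multilin v Finset.univ c) = P.eval ρ := by
    rw [prodExp_multilin hw', hP, Polynomial.eval_finsetSum, Finset.powerset_univ]
    refine Finset.sum_congr rfl fun S _ => ?_
    rw [Polynomial.eval_monomial]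
    simp only [sum_tilt_mul hmean hvar z hγ]
    rw [← Finset.prod_inter_mul_prod_sdiff S J,
      Finset.prod_congr rfl fun i hi => if_pos (Finset.mem_inter.1 hi).2,
      Finset.prod_congr (s₁ := S \ J) rfl fun i hi => if_neg (Finset.mem_sdiff.1 hi).2,
      Finset.prod_mul_distrib, Finset.prod_const]
    ring
  have hK : 0 < (5 * R) ^ (2 * d) := by positivity
  have hprob := prob_ge_of_fourth_le hw' hK hyp ht (by rw [hEf]; exact hPρ)
  have hcs := sq_prodExp_tilt_indicator_le hw (fun i a => 1 + ρ * β i * v a)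
    {x | t ≤ |multilin v Finset.univ c x|}
  simp only [sum_tilt_sq hp1 hmean hvar z hγ] at hcs
  set μA := prodExp (condWeight p J z)
        (Set.indicator {x | t ≤ |multilin v Finset.univ c x|} 1)
  have hμA : 0 ≤ μA :=
    prodExp_nonneg hw fun x => Set.indicator_nonneg (fun _ _ => zero_le_one) x
  have hprod : ∏ i, (1 + (ρ * β i) ^ 2) ≤ Real.exp (∑ i, β i ^ 2) := by
    rw [Real.exp_sum]
    refine Finset.prod_le_prod (fun i _ => by positivity) fun i _ => ?_
    have h1 : (ρ * β i) ^ 2 ≤ β i ^ 2 := by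
      rw [mul_pow]
      exact mul_le_of_le_one_left (sq_nonneg _)
        (by rw [← sq_abs]; exact pow_le_one₀ (abs_nonneg _) hρ1)
    linarith [Real.add_one_le_exp (β i ^ 2)]
  have h1 : (1 / (4 * (5 * R) ^ (2 * d))) ^ 2 ≤ Real.exp (∑ i, β i ^ 2) * μA :=
    (pow_le_pow_left₀ (by positivity) hprob 2).trans (hcs.trans (by gcongr))
  rw [Real.exp_neg]
  calc (Real.exp (∑ i, β i ^ 2))⁻¹ / (16 * (5 * R) ^ (4 * d))
      = (Real.exp (∑ i, β i ^ 2))⁻¹ * (1 / (4 * (5 * R) ^ (2 * d))) ^ 2 := by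
        rw [show 4 * d = 2 * d + 2 * d by ring, pow_add]
        field_simp
        norm_num
    _ ≤ (Real.exp (∑ i, β i ^ 2))⁻¹ * (Real.exp (∑ i, β i ^ 2) * μA) := by gcongr
    _ = μA := by rw [← mul_assoc, inv_mul_cancel₀ (Real.exp_ne_zero _), one_mul]

end

/-! ### Random restriction to a good set of coordinates. -/

section

variable {ι : Type*} [Fintype ι] [DecidableEq ι]

/-- The probability that a `δ`-random set meets `S` in exactly one point. -/
lemma prodExp_card_inter_eq_one (δ : ℝ) (S : Finset ι) :
    prodExp (fun (_ : ι) (b : Bool) => if b then δ else 1 - δ)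
      (fun x => if (S ∩ Finset.univ.filter (fun i => x i = true)).card = 1 then 1 else 0)
      = S.card * (δ * (1 - δ) ^ (S.card - 1)) := by
  -- For i ∈ S, the product of `φ i j` over j is the indicator that the random set meets S exactly
  -- in {i}. These events are disjoint and each factors over the coordinates.
  set φ : ι → ι → Bool → ℝ := fun i j b =>
    if j ∈ S then (if j = i then (if b then 1 else 0) else if b then 0 else 1) else 1 with hφ
  have h1 : ∀ x : ι → Bool,
      (if (S ∩ Finset.univ.filter (fun i => x i = true)).card = 1 then (1 : ℝ) else 0)
        = ∑ i ∈ S, ∏ j, φ i j (x j) := by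
    intro x
    have h2 : ∀ i ∈ S, ∏ j, φ i j (x j)
        = if S ∩ Finset.univ.filter (fun i => x i = true) = {i} then 1 else 0 := by
      intro i hi
      split_ifs with h
      · refine Finset.prod_eq_one fun j _ => ?_
        have hj := Finset.ext_iff.1 h j
        simp only [Finset.mem_inter, Finset.mem_filter, Finset.mem_univ, true_and,
          Finset.mem_singleton] at hj
        simp only [hφ]
        split_ifs <;> simp_all
      · obtain ⟨j, hj⟩ : ∃ j,
            ¬(j ∈ S ∩ Finset.univ.filter (fun i => x i = true) ↔ j ∈ ({i} : Finset ι)) := by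
          by_contra! hcon
          exact h (Finset.ext hcon)
        refine Finset.prod_eq_zero (Finset.mem_univ j) ?_
        simp only [Finset.mem_inter, Finset.mem_filter, Finset.mem_univ, true_and,
          Finset.mem_singleton] at hj
        simp only [hφ]
        split_ifs <;> simp_all
    rw [Finset.sum_congr rfl h2]
    split_ifs with h
    · obtain ⟨i, hi⟩ := Finset.card_eq_one.1 h
      rw [hi]
      have hiS : i ∈ S := (Finset.mem_inter.1 (hi ▸ Finset.mem_singleton_self i)).1
      simp [hiS]
    · refine (Finset.sum_eq_zero fun i _ => if_neg fun h' => h ?_).symm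
      rw [h', Finset.card_singleton]
  simp only [h1]
  rw [prodExp_sum]
  simp only [prodExp_prod]
  rw [← nsmul_eq_mul]
  refine Finset.sum_eq_card_nsmul fun i hi => ?_
  have h3 : ∀ j, ∑ b : Bool, (if b = true then δ else 1 - δ) * φ i j b
      = if j ∈ S then (if j = i then δ else 1 - δ) else 1 := by
    intro j
    by_cases hj : j ∈ S
    · by_cases hji : j = i <;> simp [hφ, hj, hji, hi]
    · simp [hφ, hj]
  rw [Finset.prod_congr rfl fun j _ => h3 j, Finset.prod_ite_mem, Finset.univ_inter,
    ← Finset.mul_prod_erase _ _ hi, if_pos rfl,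
    Finset.prod_congr rfl fun j hj => if_neg (Finset.ne_of_mem_erase hj), Finset.prod_const,
    Finset.card_erase_of_mem hi]

lemma isWeight_bernoulli {ι : Type*} {δ : ℝ} (h0 : 0 ≤ δ) (h1 : δ ≤ 1) :
    IsWeight (fun (_ : ι) (b : Bool) => if b then δ else 1 - δ) where
  nonneg _ b := by cases b <;> simp [h0, h1]
  sum_one _ := by simp

/-- The dyadic choice puts mδ between 1/4 and 1/2, and Bernoulli's inequality bounds the power below
by 1/2. -/
lemma one_div_eight_le_card_mul {m : ℕ} (hm : m ≠ 0) {δ : ℝ} (hδ : δ = 1 / 2 ^ (Nat.log 2 m + 2)) :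
    1 / 8 ≤ m * (δ * (1 - δ) ^ (m - 1)) := by
  have hδ0 : 0 < δ := by rw [hδ]; positivity
  have hle : (2 : ℝ) ^ Nat.log 2 m ≤ m := by exact_mod_cast Nat.pow_log_le_self 2 hm
  have hlt : (m : ℝ) < 2 ^ (Nat.log 2 m + 1) := by
    exact_mod_cast Nat.lt_pow_succ_log_self (by norm_num) m
  have hδ4 : δ * 2 ^ Nat.log 2 m = 1 / 4 := by rw [hδ, pow_add]; field_simp; norm_num
  have h1 : 1 / 4 ≤ m * δ := by nlinarith
  have h2 : m * δ ≤ 1 / 2 := by rw [pow_succ] at hlt; nlinarith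
  have hm1 : (1 : ℝ) ≤ m := by exact_mod_cast Nat.one_le_iff_ne_zero.2 hm
  have hb : 1 / 2 ≤ (1 - δ) ^ (m - 1) := by
    have h := one_add_mul_le_pow (a := -δ) (by nlinarith) (m - 1)
    rw [Nat.cast_sub (Nat.one_le_iff_ne_zero.2 hm)] at h
    rw [sub_eq_add_neg]
    refine le_trans ?_ h
    push_cast
    nlinarith
  calc (1 : ℝ) / 8 = 1 / 4 * (1 / 2) := by norm_num
    _ ≤ m * δ * (1 - δ) ^ (m - 1) := by gcongr
    _ = _ := by ring

/-- Some restriction leaves a `1 / log d` fraction of the Fourier weight at degree one. -/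
theorem exists_restriction {d : ℕ} {c : Finset ι → ℝ} (hc : ∀ S, d < S.card → c S = 0)
    (hvar : ∑ S ∈ Finset.univ.erase ∅, c S ^ 2 = 1) :
    ∃ J : Finset ι, 1 / (8 * (Nat.log 2 d + 1 : ℕ)) ≤
      ∑ S : Finset ι, if (S ∩ J).card = 1 then c S ^ 2 else 0 := by
  by_contra! hcon
  set W : ℕ → ι → Bool → ℝ := fun k _ b =>
    if b then 1 / 2 ^ (k + 2) else 1 - 1 / 2 ^ (k + 2) with hW
  have hWw : ∀ k, IsWeight (W k) := fun k => isWeight_bernoulli (by positivity)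
    (div_le_one_of_le₀ (one_le_pow₀ (by norm_num)) (by positivity))
  set J : (ι → Bool) → Finset ι := fun x => Finset.univ.filter (fun i => x i = true) with hJ
  have hup : ∀ k, prodExp (W k) (fun x => ∑ S : Finset ι,
      c S ^ 2 * if (S ∩ J x).card = 1 then 1 else 0) < 1 / (8 * (Nat.log 2 d + 1 : ℕ)) := by
    intro k
    -- Comparing with a maximising set keeps the inequality strict after averaging.
    obtain ⟨J₀, -, hJ₀⟩ := Finset.exists_max_image (Finset.univ : Finset (Finset ι))
      (fun J => ∑ S : Finset ι, if (S ∩ J).card = 1 then c S ^ 2 else 0) ⟨∅, Finset.mem_univ _⟩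
    refine lt_of_le_of_lt (prodExp_mono (hWw k) (G := fun _ =>
      ∑ S : Finset ι, if (S ∩ J₀).card = 1 then c S ^ 2 else 0) fun x => ?_) ?_
    · simpa only [mul_ite, mul_one, mul_zero] using hJ₀ (J x) (Finset.mem_univ _)
    · rw [prodExp_const (hWw k)]
      exact hcon J₀
  have hlow : (1 : ℝ) / 8 ≤ ∑ k ∈ Finset.range (Nat.log 2 d + 1), prodExp (W k) (fun x =>
      ∑ S : Finset ι, c S ^ 2 * if (S ∩ J x).card = 1 then 1 else 0) := by
    have hval : ∀ k (S : Finset ι), 0 ≤ prodExp (W k)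
        (fun x => if (S ∩ J x).card = 1 then (1 : ℝ) else 0) := fun k S =>
      prodExp_nonneg (hWw k) fun x => by split_ifs <;> norm_num
    simp only [prodExp_sum, prodExp_const_mul]
    rw [Finset.sum_comm]
    calc (1 : ℝ) / 8 = ∑ S ∈ Finset.univ.erase ∅, c S ^ 2 * (1 / 8) := by
          rw [← Finset.sum_mul, hvar, one_mul]
      _ ≤ ∑ S ∈ Finset.univ.erase ∅, ∑ k ∈ Finset.range (Nat.log 2 d + 1), c S ^ 2 *
            prodExp (W k) (fun x => if (S ∩ J x).card = 1 then (1 : ℝ) else 0) := by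
          refine Finset.sum_le_sum fun S hS => ?_
          by_cases hSd : d < S.card
          · simp [hc S hSd]
          rw [← Finset.mul_sum]
          refine mul_le_mul_of_nonneg_left ?_ (sq_nonneg _)
          -- Of all scales, only k = ⌊log₂ |S|⌋ is kept.
          refine le_trans ?_ (Finset.single_le_sum (fun k _ => hval k S) (Finset.mem_range.2
            (Nat.lt_succ_of_le (Nat.log_mono_right (not_lt.1 hSd)))))
          rw [hW, hJ, prodExp_card_inter_eq_one]
          exact one_div_eight_le_card_mul
            (Finset.card_ne_zero.2 (Finset.nonempty_iff_ne_empty.2 (Finset.ne_of_mem_erase hS))) rfl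
      _ ≤ _ := Finset.sum_le_sum_of_subset_of_nonneg (Finset.erase_subset _ _) fun S _ _ =>
          Finset.sum_nonneg fun k _ => mul_nonneg (sq_nonneg _) (hval k S)
  have hlt := hlow.trans_lt (Finset.sum_lt_sum_of_nonempty (by simp) fun k _ => hup k)
  rw [Finset.sum_const, Finset.card_range, nsmul_eq_mul] at hlt
  have : (0 : ℝ) < (Nat.log 2 d + 1 : ℕ) := by positivity
  field_simp at hlt
  norm_num at hlt

end

/-! ### Degree one coefficients of the restriction. -/

section

variable {ι : Type*} [DecidableEq ι]

/-- Coefficients, as a polynomial in the coordinates outside `J`, of the degree one coefficient at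
`i ∈ J`. -/
noncomputable def restrictCoeff (c : Finset ι → ℝ) (J : Finset ι) (i : ι) (T : Finset ι) : ℝ :=
  if Disjoint T J then c (insert i T) else 0

lemma restrictCoeff_eq_zero {c : Finset ι → ℝ} {d : ℕ} (hc : ∀ S, d < S.card → c S = 0)
    (J : Finset ι) (i : ι) (T : Finset ι) (hT : d < T.card) : restrictCoeff c J i T = 0 := by
  unfold restrictCoeff
  rw [hc _ (hT.trans_le (Finset.card_le_card (Finset.subset_insert _ _))), ite_self]

lemma ite_card_inter_eq_one (S J : Finset ι) (g : ℝ) :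
    (if (S ∩ J).card = 1 then g else 0) = ∑ i ∈ J, if S ∩ J = {i} then g else 0 := by
  split_ifs with h
  · obtain ⟨i, hi⟩ := Finset.card_eq_one.1 h
    have hiJ : i ∈ J := (Finset.mem_inter.1 (hi ▸ Finset.mem_singleton_self i)).2
    rw [hi]
    simp [hiJ]
  · refine (Finset.sum_eq_zero fun i _ => if_neg fun h' => h ?_).symm
    rw [h', Finset.card_singleton]

lemma insert_inter_eq_singleton {i : ι} {J T : Finset ι} (hi : i ∈ J) (hT : Disjoint T J) :
    insert i T ∩ J = {i} := by
  rw [Finset.insert_inter_of_mem hi, Finset.disjoint_iff_inter_eq_empty.1 hT]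
  rfl

variable [Fintype ι]

/-- Erasing i is a bijection from the sets meeting `J` exactly in i onto the sets disjoint from `J`.
-/
lemma sum_ite_inter_eq_singleton {i : ι} {J : Finset ι} (hi : i ∈ J) (G : Finset ι → ℝ) :
    ∑ S : Finset ι, (if S ∩ J = {i} then G S else 0)
      = ∑ T : Finset ι, if Disjoint T J then G (insert i T) else 0 := by
  rw [← Finset.sum_filter, ← Finset.sum_filter]
  refine Finset.sum_nbij' (fun S => S.erase i) (fun T => insert i T) ?_ ?_ ?_ ?_ ?_
  · intro S hS
    have hS := (Finset.mem_filter.1 hS).2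
    refine Finset.mem_filter.2 ⟨Finset.mem_univ _, Finset.disjoint_left.2 fun j hj hjJ => ?_⟩
    have : j ∈ S ∩ J := Finset.mem_inter.2 ⟨Finset.mem_of_mem_erase hj, hjJ⟩
    rw [hS, Finset.mem_singleton] at this
    exact Finset.ne_of_mem_erase hj this
  · intro T hT
    exact Finset.mem_filter.2 ⟨Finset.mem_univ _,
      insert_inter_eq_singleton hi (Finset.mem_filter.1 hT).2⟩
  · intro S hS
    have hS := (Finset.mem_filter.1 hS).2
    exact Finset.insert_erase (Finset.mem_inter.1 (hS ▸ Finset.mem_singleton_self i)).1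
  · intro T hT
    exact Finset.erase_insert fun h =>
      Finset.disjoint_left.1 (Finset.mem_filter.1 hT).2 h hi
  · intro S hS
    have hS := (Finset.mem_filter.1 hS).2
    rw [Finset.insert_erase (Finset.mem_inter.1 (hS ▸ Finset.mem_singleton_self i)).1]

lemma sum_restrictCoeff_sq (c : Finset ι → ℝ) {J : Finset ι} {i : ι} (hi : i ∈ J) :
    ∑ T, restrictCoeff c J i T ^ 2 = ∑ S : Finset ι, if S ∩ J = {i} then c S ^ 2 else 0 := by
  rw [sum_ite_inter_eq_singleton hi]
  refine Finset.sum_congr rfl fun T _ => ?_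
  unfold restrictCoeff
  split_ifs <;> simp

lemma sum_sum_restrictCoeff_sq (c : Finset ι → ℝ) (J : Finset ι) :
    ∑ i ∈ J, ∑ T, restrictCoeff c J i T ^ 2
      = ∑ S : Finset ι, if (S ∩ J).card = 1 then c S ^ 2 else 0 := by
  rw [Finset.sum_congr rfl fun i hi => sum_restrictCoeff_sq c hi, Finset.sum_comm]
  simp only [ite_card_inter_eq_one]

/-- This is how the influence hypothesis enters: it bounds the second moment of each random
coefficient a_i. -/
lemma sum_restrictCoeff_sq_le (c : Finset ι → ℝ) {J : Finset ι} {i : ι} (hi : i ∈ J) :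
    ∑ T, restrictCoeff c J i T ^ 2 ≤ ∑ S : Finset ι, if i ∈ S then c S ^ 2 else 0 := by
  rw [sum_restrictCoeff_sq c hi]
  refine Finset.sum_le_sum fun S _ => ?_
  by_cases h : S ∩ J = {i}
  · rw [if_pos h, if_pos (Finset.mem_inter.1 (h ▸ Finset.mem_singleton_self i)).1]
  · rw [if_neg h]
    split_ifs <;> positivity

/-- The degree one part at `β` of the restriction to `J`. -/
lemma sum_mul_multilin_restrictCoeff {α : Type*} (v : α → ℝ) (c : Finset ι → ℝ) (J : Finset ι)
    (β : ι → ℝ) (z : ι → α) :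
    (∑ S, if (S ∩ J).card = 1 then
      c S * ((∏ i ∈ S ∩ J, β i) * ∏ i ∈ S \ J, v (z i)) else 0)
      = ∑ i ∈ J, β i * multilin v Finset.univ (restrictCoeff c J i) z := by
  simp only [ite_card_inter_eq_one]
  rw [Finset.sum_comm]
  refine Finset.sum_congr rfl fun i hi => ?_
  rw [sum_ite_inter_eq_singleton hi, multilin, Finset.powerset_univ, Finset.mul_sum]
  refine Finset.sum_congr rfl fun T _ => ?_
  unfold restrictCoeff
  split_ifs with h
  · rw [insert_inter_eq_singleton hi h, Finset.prod_singleton, Finset.insert_sdiff_of_mem _ hi,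
      Finset.sdiff_eq_self_of_disjoint h]
    ring
  · simp

variable {α : Type*} [Fintype α] {w : ι → α → ℝ}

/-- If each `a i` has controlled fourth moment and small second moment, then `∑ (a i)²` restricted
to the small `a i` is comparable to its mean with substantial probability. -/
lemma le_prob_sum_trunc_sq (hw : IsWeight w) (J : Finset ι) (a : ι → (ι → α) → ℝ) {K τ η σ : ℝ}
    (hK : 0 < K) (hη : 0 < η) (hτη : 2 * K * τ ≤ η ^ 2)
    (h4 : ∀ i ∈ J, prodExp w (fun x => a i x ^ 4) ≤ K * prodExp w (fun x => a i x ^ 2) ^ 2)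
    (hτ : ∀ i ∈ J, prodExp w (fun x => a i x ^ 2) ≤ τ)
    (hσ : ∑ i ∈ J, prodExp w (fun x => a i x ^ 2) = σ) (hσ0 : 0 < σ) :
    1 / (16 * K) ≤ prodExp w (Set.indicator
      {x | σ / 4 ≤ ∑ i ∈ J, (if |a i x| ≤ η then a i x else 0) ^ 2} 1) := by
  set b : ι → (ι → α) → ℝ := fun i x => if |a i x| ≤ η then a i x else 0 with hb
  have hba : ∀ i x, b i x ^ 2 ≤ a i x ^ 2 := fun i x => by
    simp only [hb]
    split_ifs
    · exact le_rfl
    · rw [zero_pow two_ne_zero]; positivity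
  -- The part lost by truncation is paid for by fourth moments. In total these cost at most Kτσ/η² ≤
  -- σ/2, so half the mean survives.
  have hab : ∀ i x, a i x ^ 2 ≤ b i x ^ 2 + (η ^ 2)⁻¹ * a i x ^ 4 := fun i x => by
    simp only [hb]
    split_ifs with h
    · have : 0 ≤ (η ^ 2)⁻¹ * a i x ^ 4 := by positivity
      linarith
    · have h1 : η ^ 2 ≤ a i x ^ 2 := by
        rw [← sq_abs (a i x)]
        have := (not_le.1 h).le
        gcongr
      rw [inv_mul_eq_div, zero_pow two_ne_zero, zero_add, le_div_iff₀ (by positivity)]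
      nlinarith [sq_nonneg (a i x)]
  have hE0 : ∀ i, 0 ≤ prodExp w (fun x => a i x ^ 2) := fun i =>
    prodExp_nonneg hw fun x => sq_nonneg _
  have hmean : 2 * (σ / 4) ≤ prodExp w (fun x => ∑ i ∈ J, b i x ^ 2) := by
    have h1 : σ ≤ prodExp w (fun x => ∑ i ∈ J, b i x ^ 2)
        + (η ^ 2)⁻¹ * ∑ i ∈ J, prodExp w (fun x => a i x ^ 4) := by
      rw [← hσ, prodExp_sum, Finset.mul_sum, ← Finset.sum_add_distrib]
      refine Finset.sum_le_sum fun i _ => ?_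
      rw [← prodExp_const_mul, ← prodExp_add]
      exact prodExp_mono hw fun x => hab i x
    have h2 : ∑ i ∈ J, prodExp w (fun x => a i x ^ 4) ≤ K * τ * σ := by
      rw [← hσ, Finset.mul_sum]
      refine Finset.sum_le_sum fun i hi => (h4 i hi).trans ?_
      calc K * prodExp w (fun x => a i x ^ 2) ^ 2
          = K * prodExp w (fun x => a i x ^ 2) * prodExp w (fun x => a i x ^ 2) := by ring
        _ ≤ K * τ * prodExp w (fun x => a i x ^ 2) := by gcongr; exacts [hE0 i, hτ i hi]
    have h3 : (η ^ 2)⁻¹ * ∑ i ∈ J, prodExp w (fun x => a i x ^ 4) ≤ σ / 2 := by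
      rw [inv_mul_eq_div, div_le_iff₀ (by positivity)]
      refine h2.trans ?_
      nlinarith
    linarith
  have hsq : prodExp w (fun x => (∑ i ∈ J, b i x ^ 2) ^ 2) ≤ K * σ ^ 2 := by
    calc prodExp w (fun x => (∑ i ∈ J, b i x ^ 2) ^ 2)
        ≤ prodExp w (fun x => ∑ i ∈ J, ∑ j ∈ J, a i x ^ 2 * a j x ^ 2) := by
          refine prodExp_mono hw fun x => ?_
          rw [sq, Finset.sum_mul_sum]
          refine Finset.sum_le_sum fun i _ => Finset.sum_le_sum fun j _ => ?_
          exact mul_le_mul (hba i x) (hba j x) (sq_nonneg _) (sq_nonneg _)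
      _ = ∑ i ∈ J, ∑ j ∈ J, prodExp w (fun x => a i x ^ 2 * a j x ^ 2) := by
          simp only [prodExp_sum]
      _ ≤ ∑ i ∈ J, ∑ j ∈ J,
            K * (prodExp w (fun x => a i x ^ 2) * prodExp w (fun x => a j x ^ 2)) := by
          refine Finset.sum_le_sum fun i hi => Finset.sum_le_sum fun j hj => ?_
          have hEi := hE0 i
          have hEj := hE0 j
          refine le_trans (le_abs_self _) (abs_le_of_sq_le_sq ?_ (by positivity))
          have hcs := sq_prodExp_mul_le hw (fun x => a i x ^ 2) (fun x => a j x ^ 2)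
          simp only [← pow_mul] at hcs
          refine hcs.trans ((mul_le_mul (h4 i hi) (h4 j hj) (prodExp_nonneg hw fun x =>
            (show Even 4 by decide).pow_nonneg _) (by positivity)).trans (le_of_eq ?_))
          ring
      _ = K * σ ^ 2 := by
          simp only [← Finset.mul_sum]
          rw [← Finset.sum_mul, hσ, sq]
  have hpz := paley_zygmund hw (F := fun x => ∑ i ∈ J, b i x ^ 2) (s := σ / 4) (by positivity) hmean
  have hP : 0 ≤ prodExp w (Set.indicator {x | σ / 4 ≤ ∑ i ∈ J, b i x ^ 2} 1) :=
    prodExp_nonneg hw fun x => Set.indicator_nonneg (fun _ _ => zero_le_one) x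
  have h := hpz.trans (mul_le_mul_of_nonneg_right hsq hP)
  rw [div_le_iff₀ (by positivity)]
  have hσ2 : 0 < σ ^ 2 := by positivity
  nlinarith

end

/-! ### Choice of the tilt and the bound with explicit constants. -/

/-- The conditional bound with the tilt chosen proportional to the degree one coefficients. -/
lemma le_prodExp_condWeight_of_sum_sq {ι α : Type*} [Fintype ι] [DecidableEq ι] [Fintype α]
    [DecidableEq α] {p v : α → ℝ} (hp : ∀ a, 0 ≤ p a) (hp1 : ∑ a, p a = 1)
    (hmean : ∑ a, p a * v a = 0) (hvar : ∑ a, p a * v a ^ 2 = 1) {R : ℝ} (hR1 : 1 ≤ R)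
    (hR : ∀ a, |v a| ≤ R) {d : ℕ} (hd : 1 ≤ d) {c : Finset ι → ℝ}
    (hc : ∀ S, d < S.card → c S = 0) {t : ℝ} (ht : 0 < t) (J : Finset ι) (z : ι → α)
    {b : ι → ℝ} {η A : ℝ} (hbη : ∀ i, |b i| ≤ η)
    (hb : ∀ i, b i * multilin v Finset.univ (restrictCoeff c J i) z = b i ^ 2)
    (hA : ∑ i ∈ J, b i ^ 2 = A) (hA0 : 0 < A) (hη : 6 * t * d * η * R ≤ A) :
    Real.exp (-(9 * t ^ 2 * d ^ 2 / A)) / (16 * (5 * R) ^ (4 * d)) ≤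
      prodExp (condWeight p J z)
        (Set.indicator {x | t ≤ |multilin v Finset.univ c x|} 1) := by
  have hd0 : (1 : ℝ) ≤ d := by exact_mod_cast hd
  -- This scaling makes the degree one part at β exactly 3td, while ∑ β_i² = θ²A = 9t²d²/A.
  set θ : ℝ := 3 * t * d / A with hθ
  have hθ0 : 0 < θ := by positivity
  set β : ι → ℝ := fun i => if i ∈ J then θ * b i else 0 with hβ
  have hβ0 : ∀ i ∉ J, β i = 0 := fun i hi => if_neg hi
  have hβR : ∀ i, |β i| * R ≤ 1 / 2 := fun i => by
    simp only [hβ]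
    split_ifs
    · rw [abs_mul, abs_of_pos hθ0]
      have hθη : θ * η * R ≤ 1 / 2 := by
        rw [hθ, show 3 * t * d / A * η * R = 6 * t * d * η * R / (2 * A) by field_simp; ring,
          div_le_iff₀ (by positivity)]
        linarith
      exact (mul_le_mul_of_nonneg_right (mul_le_mul_of_nonneg_left (hbη i) hθ0.le)
        (by linarith)).trans hθη
    · norm_num
  have hlin : 3 * t * d ≤ ∑ S, if (S ∩ J).card = 1 then
      c S * ((∏ i ∈ S ∩ J, β i) * ∏ i ∈ S \ J, v (z i)) else 0 := by
    rw [sum_mul_multilin_restrictCoeff]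
    refine le_of_eq ?_
    calc 3 * t * d = θ * A := by rw [hθ]; field_simp
      _ = ∑ i ∈ J, θ * b i ^ 2 := by rw [← hA, Finset.mul_sum]
      _ = _ := Finset.sum_congr rfl fun i hi => by
        rw [← hb i, ← mul_assoc]
        simp only [hβ, if_pos hi]
  have hsum : ∑ i, β i ^ 2 = 9 * t ^ 2 * d ^ 2 / A := by
    calc ∑ i, β i ^ 2 = ∑ i, if i ∈ J then θ ^ 2 * b i ^ 2 else 0 :=
          Finset.sum_congr rfl fun i _ => by
            simp only [hβ]
            split_ifs <;> ring
      _ = θ ^ 2 * A := by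
        rw [Finset.sum_ite_mem, Finset.univ_inter, ← hA, Finset.mul_sum]
      _ = _ := by rw [hθ]; field_simp; norm_num
  rw [← hsum]
  exact le_prodExp_condWeight hp hp1 hmean hvar hR1 hR z hβ0 hβR hd hc ht hlin

/-- The large deviation bound with explicit constants for finite product spaces. -/
theorem le_prodExp_abs_multilin_ge {ι α : Type*} [Fintype ι] [DecidableEq ι] [Fintype α]
    [DecidableEq α] {p v : α → ℝ} (hp : ∀ a, 0 ≤ p a) (hp1 : ∑ a, p a = 1)
    (hmean : ∑ a, p a * v a = 0) (hvar : ∑ a, p a * v a ^ 2 = 1) {R : ℝ} (hR1 : 1 ≤ R)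
    (hR : ∀ a, |v a| ≤ R) {d : ℕ} (hd : 1 ≤ d) {c : Finset ι → ℝ}
    (hc : ∀ S, d < S.card → c S = 0) (hcvar : ∑ S ∈ Finset.univ.erase ∅, c S ^ 2 = 1)
    {t : ℝ} (ht : 1 ≤ t) {τ : ℝ} (hinf : ∀ i, (∑ S : Finset ι, if i ∈ S then c S ^ 2 else 0) ≤ τ)
    (hτ : τ * (73728 * R ^ 2 * t ^ 2 * d ^ 4 * (5 * R) ^ (2 * d)) ≤ 1) :
    Real.exp (-(288 * (Nat.log 2 d + 1 : ℕ) * t ^ 2 * d ^ 2)) / (256 * (5 * R) ^ (6 * d)) ≤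
      prodExp (fun _ : ι => p) (Set.indicator {x | t ≤ |multilin v Finset.univ c x|} 1) := by
  obtain ⟨J, hJ⟩ := exists_restriction hc hcvar
  rw [← sum_sum_restrictCoeff_sq] at hJ
  set N : ℝ := ((Nat.log 2 d + 1 : ℕ) : ℝ) with hN
  have hN1 : 1 ≤ N := by rw [hN]; exact_mod_cast Nat.succ_le_succ (Nat.zero_le _)
  have hNd : N ≤ d := by
    rw [hN]
    exact_mod_cast Nat.log_lt_self 2 (by omega)
  have hd0 : (1 : ℝ) ≤ d := by exact_mod_cast hd
  set K : ℝ := (5 * R) ^ (2 * d) with hK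
  have hK0 : 0 < K := by positivity
  have hw : IsWeight (fun _ : ι => p) := ⟨fun _ => hp, fun _ => hp1⟩
  set a : ι → (ι → α) → ℝ := fun i => multilin v Finset.univ (restrictCoeff c J i) with ha
  have hsq : ∀ i, prodExp (fun _ : ι => p) (fun x => a i x ^ 2)
      = ∑ T, restrictCoeff c J i T ^ 2 := fun i => by
    rw [prodExp_multilin_sq hw v (fun _ => hmean) (fun _ => hvar), Finset.powerset_univ]
  set σ := ∑ i ∈ J, ∑ T, restrictCoeff c J i T ^ 2 with hσ
  have hσ0 : 0 < σ := lt_of_lt_of_le (by positivity) hJ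
  have hfour : ∀ i, prodExp (fun _ : ι => p) (fun x => a i x ^ 4)
      ≤ K * prodExp (fun _ : ι => p) (fun x => a i x ^ 2) ^ 2 := by
    intro i
    refine prodExp_multilin_fourth_le hw v (L := 5 * R) (B := 8 * R ^ 2) (by linarith)
      (by positivity) (by nlinarith) (fun j => ?_) Finset.univ d _
      (fun S _ => restrictCoeff_eq_zero hc J i S)
    rcases isEmpty_or_nonempty α with hα | ⟨⟨a₀⟩⟩
    · simp
    -- The zero tilt on a single free coordinate recovers the moment bound for p itself.
    have := tilt_fourth_le hp hp1 hmean hvar hR1 hR (J := {j}) (fun _ => a₀) (γ := fun _ => 0)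
      (fun _ _ => rfl) (fun _ => by norm_num) j
    simpa [condWeight] using this
  -- The largest truncation level allowed by 6tdηR ≤ σ/4, hence by the positivity of the tilted
  -- density.
  set η : ℝ := σ / (24 * R * t * d) with hη
  have hη0 : 0 < η := by positivity
  -- Bounding the number of scales crudely by d gives 8dσ ≥ 1. The constant in the influence bound
  -- is 73728 = 64 · 2 · 24².
  have hτη : 2 * K * τ ≤ η ^ 2 := by
    have hσN : 1 ≤ 8 * d * σ := by
      have : 1 ≤ 8 * N * σ := by
        rw [div_le_iff₀ (by positivity)] at hJ
        linarith
      linarith [mul_le_mul_of_nonneg_right hNd hσ0.le]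
    have h1 : (1 : ℝ) ≤ 64 * d ^ 2 * σ ^ 2 := by
      refine (one_le_pow₀ hσN (n := 2)).trans (le_of_eq ?_)
      ring
    rw [hη, div_pow, le_div_iff₀ (by positivity)]
    have h2 : τ * (73728 * R ^ 2 * t ^ 2 * d ^ 4 * K)
      = 64 * d ^ 2 * (2 * K * τ * (24 * R * t * d) ^ 2) := by ring
    rw [h2] at hτ
    have h3 : 64 * d ^ 2 * (2 * K * τ * (24 * R * t * d) ^ 2) ≤ 64 * (d : ℝ) ^ 2 * σ ^ 2 :=
      hτ.trans h1
    exact le_of_mul_le_mul_left h3 (by positivity)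
  have hgood := le_prob_sum_trunc_sq hw J a hK0 hη0 hτη (fun i _ => hfour i)
    (fun i hi => by rw [hsq]; exact (sum_restrictCoeff_sq_le c hi).trans (hinf i))
    (σ := σ) (by simp only [hsq, hσ]) hσ0
  set q : ℝ := Real.exp (-(288 * N * t ^ 2 * d ^ 2)) / (16 * (5 * R) ^ (4 * d)) with hq
  set Z : Set (ι → α) := {x | σ / 4 ≤ ∑ i ∈ J, (if |a i x| ≤ η then a i x else 0) ^ 2} with hZ
  have hcond : ∀ z, q * Set.indicator Z 1 z ≤ prodExp (condWeight p J z)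
      (Set.indicator {x | t ≤ |multilin v Finset.univ c x|} 1) := by
    intro z
    by_cases hz : z ∈ Z
    swap
    · rw [Set.indicator_of_notMem hz, mul_zero]
      exact prodExp_nonneg (isWeight_condWeight hp hp1 J z)
        fun x => Set.indicator_nonneg (fun _ _ => zero_le_one) x
    rw [Set.indicator_of_mem hz, Pi.one_apply, mul_one]
    set b : ι → ℝ := fun i => if |a i z| ≤ η then a i z else 0 with hb
    set A := ∑ i ∈ J, b i ^ 2 with hA
    have hAσ : σ / 4 ≤ A := hz
    have hA0 : 0 < A := lt_of_lt_of_le (by positivity) hAσ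
    have hbη : ∀ i, |b i| ≤ η := fun i => by
      simp only [hb]
      split_ifs with h
      · exact h
      · rw [abs_zero]; exact hη0.le
    have hbi : ∀ i, b i * a i z = b i ^ 2 := fun i => by
      simp only [hb]
      split_ifs <;> ring
    refine le_trans ?_ (le_prodExp_condWeight_of_sum_sq hp hp1 hmean hvar hR1 hR hd hc
      (by linarith) J z hbη hbi rfl hA0 ?_)
    swap
    · rw [hη, show 6 * t * d * (σ / (24 * R * t * d)) * R = σ / 4 by field_simp; norm_num]
      exact hAσ
    rw [hq]
    gcongr
    rw [div_le_iff₀ hA0]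
    have hNA : 1 ≤ 32 * N * A := by
      rw [div_le_iff₀ (by positivity)] at hJ
      linarith [mul_le_mul_of_nonneg_right hAσ (show (0 : ℝ) ≤ 8 * N by positivity)]
    have h9 : 0 ≤ 9 * t ^ 2 * (d : ℝ) ^ 2 := by positivity
    linarith [mul_le_mul_of_nonneg_left hNA h9]
  rw [← prodExp_condWeight hp1 J]
  refine le_trans ?_ (prodExp_mono hw hcond)
  rw [prodExp_const_mul]
  calc Real.exp (-(288 * N * t ^ 2 * d ^ 2)) / (256 * (5 * R) ^ (6 * d)) = q * (1 / (16 * K)) := by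
        rw [hq, hK, show 6 * d = 4 * d + 2 * d by ring, pow_add]
        field_simp
        norm_num
    _ ≤ _ := by gcongr

/-! ### Multilinear polynomials as families of coefficients. -/

section

variable {n : ℕ}

/-- The coefficient of `∏ i ∈ S, X i`. -/
noncomputable def MvPolynomial.setCoeff (f : MvPolynomial (Fin n) ℝ) (S : Finset (Fin n)) : ℝ :=
  f.coeff (Finsupp.indicator S fun _ _ => 1)

lemma Finsupp.indicator_one_apply (S : Finset (Fin n)) (i : Fin n) :
    (Finsupp.indicator S fun _ _ => 1 : Fin n →₀ ℕ) i = if i ∈ S then 1 else 0 := by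
  simp [Finsupp.indicator_apply]

lemma IsMultilinear.eq_sum {f : MvPolynomial (Fin n) ℝ} (hf : IsMultilinear f) :
    f = ∑ S : Finset (Fin n), MvPolynomial.monomial (Finsupp.indicator S fun _ _ => 1)
      (f.setCoeff S) := by
  ext m
  rw [MvPolynomial.coeff_sum]
  simp only [MvPolynomial.coeff_monomial]
  by_cases hm : m ∈ f.support
  · have hm1 : ∀ i, m i ≤ 1 := fun i => (MvPolynomial.monomial_le_degreeOf i hm).trans (hf i)
    have hms : (Finsupp.indicator m.support fun _ _ => 1 : Fin n →₀ ℕ) = m := by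
      ext i
      rw [Finsupp.indicator_one_apply]
      have := hm1 i
      split_ifs with h
      · rw [Finsupp.mem_support_iff] at h; omega
      · rw [Finsupp.notMem_support_iff] at h; exact h.symm
    rw [Finset.sum_eq_single m.support]
    · rw [if_pos hms, MvPolynomial.setCoeff, hms]
    · intro S _ hS
      refine if_neg fun h => hS ?_
      ext i
      rw [← h, Finsupp.mem_support_iff, Finsupp.indicator_one_apply]
      simp
    · exact fun h => absurd (Finset.mem_univ _) h
  · rw [MvPolynomial.notMem_support_iff.1 hm]
    refine (Finset.sum_eq_zero fun S _ => ?_).symm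
    split_ifs with h
    · rw [MvPolynomial.setCoeff, h, MvPolynomial.notMem_support_iff.1 hm]
    · rfl

lemma MvPolynomial.setCoeff_eq_zero {f : MvPolynomial (Fin n) ℝ} {d : ℕ}
    (hd : f.totalDegree ≤ d) (S : Finset (Fin n)) (hS : d < S.card) : f.setCoeff S = 0 := by
  refine MvPolynomial.coeff_eq_zero_of_totalDegree_lt (hd.trans_lt (hS.trans_le (le_of_eq ?_)))
  have hsupp : (Finsupp.indicator S fun _ _ => 1 : Fin n →₀ ℕ).support = S := by
    ext i
    rw [Finsupp.mem_support_iff, Finsupp.indicator_one_apply]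
    simp
  rw [hsupp, Finset.sum_congr rfl fun i hi => (Finsupp.indicator_one_apply S i).trans (if_pos hi)]
  simp

lemma MvPolynomial.eval_monomial_indicator (S : Finset (Fin n)) (r : ℝ) (x : Fin n → ℝ) :
    MvPolynomial.eval x (MvPolynomial.monomial (Finsupp.indicator S fun _ _ => 1) r)
      = r * ∏ i ∈ S, x i := by
  rw [MvPolynomial.eval_monomial, Finsupp.prod_fintype _ _ fun i => pow_zero _]
  simp only [Finsupp.indicator_one_apply, pow_ite, pow_one, pow_zero]
  rw [Finset.prod_ite_mem, Finset.univ_inter]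

lemma IsMultilinear.eval_eq {f : MvPolynomial (Fin n) ℝ} (hf : IsMultilinear f) {α : Type*}
    (v : α → ℝ) (x : Fin n → α) :
    MvPolynomial.eval (fun i => v (x i)) f = multilin v Finset.univ f.setCoeff x := by
  conv_lhs => rw [hf.eq_sum]
  rw [map_sum, multilin, Finset.powerset_univ]
  exact Finset.sum_congr rfl fun S _ => MvPolynomial.eval_monomial_indicator _ _ _

lemma IsMultilinear.eval_pderiv_eq {f : MvPolynomial (Fin n) ℝ} (hf : IsMultilinear f)
    {α : Type*} (v : α → ℝ) (i : Fin n) (x : Fin n → α) :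
    MvPolynomial.eval (fun i => v (x i)) (MvPolynomial.pderiv i f)
      = multilin v Finset.univ (restrictCoeff f.setCoeff {i} i) x := by
  conv_lhs => rw [hf.eq_sum]
  have h : ∀ S : Finset (Fin n), MvPolynomial.eval (fun i => v (x i)) (MvPolynomial.pderiv i
      (MvPolynomial.monomial (Finsupp.indicator S fun _ _ => 1) (f.setCoeff S)))
      = if S ∩ {i} = {i} then f.setCoeff S * ∏ j ∈ S.erase i, v (x j) else 0 := by
    intro S
    rw [MvPolynomial.pderiv_monomial, Finsupp.indicator_one_apply]
    have hSi : S ∩ {i} = {i} ↔ i ∈ S := by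
      rw [Finset.inter_eq_right, Finset.singleton_subset_iff]
    simp only [hSi]
    split_ifs with hi
    · have : (Finsupp.indicator S fun _ _ => 1 : Fin n →₀ ℕ) - Finsupp.single i 1
          = Finsupp.indicator (S.erase i) fun _ _ => 1 := by
        ext j
        rw [Finsupp.tsub_apply, Finsupp.indicator_one_apply, Finsupp.indicator_one_apply,
          Finsupp.single_apply]
        by_cases hj : i = j
        · subst hj; simp [hi]
        · simp [hj, Ne.symm hj]
      rw [this, MvPolynomial.eval_monomial_indicator]
      simp
    · simp
  simp only [map_sum, h]
  rw [sum_ite_inter_eq_singleton (Finset.mem_singleton_self i), multilin, Finset.powerset_univ]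
  refine Finset.sum_congr rfl fun T _ => ?_
  unfold restrictCoeff
  split_ifs with hT
  · rw [Finset.erase_insert (Finset.disjoint_singleton_right.1 hT)]
  · simp

end

/-! ### From measures to finite sums. -/

section

/-- A finitely supported probability measure is the law of the inclusion of a finite set. -/
lemma FinitelySupported.exists_map {μ : Measure ℝ} [IsProbabilityMeasure μ]
    (h : FinitelySupported μ) : ∃ (s : Finset ℝ) (m : Measure s), IsProbabilityMeasure m ∧
      μ = m.map Subtype.val := by
  obtain ⟨s, hs⟩ := h
  have hmap : (μ.comap (Subtype.val : s → ℝ)).map Subtype.val = μ := by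
    have := map_comap_subtype_coe (s := (s : Set ℝ)) s.measurableSet μ
    refine this.trans (Measure.restrict_eq_self_of_ae_mem ?_)
    rw [ae_iff]
    exact hs
  refine ⟨s, μ.comap Subtype.val, ⟨?_⟩, hmap.symm⟩
  have h1 : μ Set.univ = 1 := measure_univ
  rw [← hmap, Measure.map_apply measurable_subtype_coe MeasurableSet.univ, Set.preimage_univ] at h1
  exact h1

variable {α : Type*} [Fintype α] [MeasurableSpace α] [MeasurableSingletonClass α]
  {m : Measure α} [IsProbabilityMeasure m] {v : α → ℝ} {n : ℕ}

lemma integral_pi_eq_prodExp (F : (Fin n → α) → ℝ) :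
    ∫ x, F x ∂(Measure.pi fun _ : Fin n => m) = prodExp (fun _ a => m.real {a}) F := by
  rw [integral_fintype Integrable.of_finite]
  refine Finset.sum_congr rfl fun x _ => ?_
  rw [measureReal_def, Measure.pi_singleton, ENNReal.toReal_prod, smul_eq_mul]
  rfl

lemma productLaw_map :
    productLaw (m.map v) n = (Measure.pi fun _ : Fin n => m).map (fun x i => v (x i)) := by
  have hv : Measurable v := Measurable.of_discrete
  have : IsProbabilityMeasure (m.map v) := Measure.isProbabilityMeasure_map hv.aemeasurable
  exact (Measure.pi_map_pi fun _ => hv.aemeasurable).symm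

lemma integral_productLaw_map {F : (Fin n → ℝ) → ℝ} (hF : Measurable F) :
    ∫ x, F x ∂(productLaw (m.map v) n)
      = prodExp (fun _ a => m.real {a}) (fun x => F fun i => v (x i)) := by
  rw [productLaw_map, integral_map Measurable.of_discrete.aemeasurable hF.aestronglyMeasurable,
    integral_pi_eq_prodExp]

lemma variance_productLaw_map {F : (Fin n → ℝ) → ℝ} (hF : Measurable F) :
    variance F (productLaw (m.map v) n)
      = prodExp (fun _ a => m.real {a}) (fun x => F (fun i => v (x i)) ^ 2)
        - prodExp (fun _ a => m.real {a}) (fun x => F fun i => v (x i)) ^ 2 := by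
  rw [productLaw_map, variance_map hF.aemeasurable Measurable.of_discrete.aemeasurable,
    variance_eq_sub MemLp.of_discrete, integral_pi_eq_prodExp, integral_pi_eq_prodExp]
  rfl

lemma productLaw_map_real {A : Set (Fin n → ℝ)} (hA : MeasurableSet A) :
    (productLaw (m.map v) n).real A = prodExp (fun _ a => m.real {a})
      (Set.indicator {x | (fun i => v (x i)) ∈ A} 1) := by
  rw [← integral_indicator_one hA, integral_productLaw_map (measurable_one.indicator hA)]
  rfl

lemma IsMultilinear.variance_eq {f : MvPolynomial (Fin n) ℝ} (hf : IsMultilinear f)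
    (hmean : ∑ a, m.real {a} * v a = 0) (hvar : ∑ a, m.real {a} * v a ^ 2 = 1) :
    variance (fun x => MvPolynomial.eval x f) (productLaw (m.map v) n)
      = ∑ S ∈ Finset.univ.erase ∅, f.setCoeff S ^ 2 := by
  have hw : IsWeight (fun (_ : Fin n) a => m.real {a}) :=
    ⟨fun _ _ => measureReal_nonneg, fun _ => by simp⟩
  rw [variance_productLaw_map (MvPolynomial.continuous_eval f).measurable]
  simp only [hf.eval_eq]
  rw [prodExp_multilin_sq hw v (fun _ => hmean) (fun _ => hvar), prodExp_multilin hw,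
    Finset.powerset_univ, ← Finset.add_sum_erase _ _ (Finset.mem_univ ∅),
    Finset.sum_eq_single ∅ (fun S _ hS => ?_) (fun h => absurd (Finset.mem_univ _) h)]
  · simp
  · obtain ⟨i, hi⟩ := Finset.nonempty_iff_ne_empty.2 hS
    rw [Finset.prod_eq_zero hi hmean, mul_zero]

/-- The derivative is again multilinear, and its coefficients are the c_S with S ∋ i, so Parseval
applies to it. -/
lemma IsMultilinear.influence_eq {f : MvPolynomial (Fin n) ℝ} (hf : IsMultilinear f)
    (hmean : ∑ a, m.real {a} * v a = 0) (hvar : ∑ a, m.real {a} * v a ^ 2 = 1) (i : Fin n) :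
    influence (m.map v) f i = ∑ S : Finset (Fin n), if i ∈ S then f.setCoeff S ^ 2 else 0 := by
  have hw : IsWeight (fun (_ : Fin n) a => m.real {a}) :=
    ⟨fun _ _ => measureReal_nonneg, fun _ => by simp⟩
  rw [influence, integral_productLaw_map ((MvPolynomial.continuous_eval _).measurable.pow_const 2)]
  simp only [hf.eval_pderiv_eq]
  rw [prodExp_multilin_sq hw v (fun _ => hmean) (fun _ => hvar), Finset.powerset_univ,
    sum_restrictCoeff_sq _ (Finset.mem_singleton_self i)]
  simp only [Finset.inter_eq_right, Finset.singleton_subset_iff]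

end

/-! ### Comparison of constants and conclusion. -/

/-- Comparison of the explicit lower bound with the stated one. -/
lemma exp_neg_le_explicit_bound {R t : ℝ} (hR : 1 ≤ R) (ht : 1 ≤ t) {d : ℕ} (hd : 1 ≤ d) :
    Real.exp (-(29491200 * R ^ 4 * t ^ 2 * (d : ℝ) ^ 2 * Real.log (max (d : ℝ) 2)))
      ≤ Real.exp (-(288 * (Nat.log 2 d + 1 : ℕ) * t ^ 2 * d ^ 2)) / (256 * (5 * R) ^ (6 * d)) := by
  have hd1 : (1 : ℝ) ≤ d := by exact_mod_cast hd
  set ℓ := Real.log (max (d : ℝ) 2) with hℓ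
  have hlog2 : 1 / 2 ≤ Real.log 2 := by linarith [Real.log_two_gt_d9]
  have hℓ2 : 1 / 2 ≤ ℓ := hlog2.trans (Real.log_le_log (by norm_num) (le_max_right _ _))
  have hN : ((Nat.log 2 d + 1 : ℕ) : ℝ) ≤ 4 * ℓ := by
    have h1 : (Nat.log 2 d : ℝ) * Real.log 2 ≤ ℓ := by
      rw [← Real.log_pow]
      refine Real.log_le_log (by positivity) (le_trans ?_ (le_max_left _ _))
      exact_mod_cast Nat.pow_log_le_self 2 (by omega)
    have h2 : (0 : ℝ) ≤ Nat.log 2 d := by positivity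
    push_cast
    nlinarith
  have hexp : 256 * (5 * R) ^ (6 * d) ≤ Real.exp (256 + 30 * R * d) := by
    rw [Real.exp_add]
    have h1 : (256 : ℝ) ≤ Real.exp 256 := by linarith [Real.add_one_le_exp 256]
    have h2 : (5 * R) ^ (6 * d) ≤ Real.exp (30 * R * d) := by
      have : 5 * R ≤ Real.exp (5 * R) := by linarith [Real.add_one_le_exp (5 * R)]
      calc (5 * R) ^ (6 * d) ≤ Real.exp (5 * R) ^ (6 * d) := by gcongr
        _ = Real.exp (30 * R * d) := by
          rw [← Real.exp_nat_mul]; congr 1; push_cast; ring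
    gcongr
  rw [le_div_iff₀ (by positivity)]
  refine (mul_le_mul_of_nonneg_left hexp (Real.exp_pos _).le).trans ?_
  rw [← Real.exp_add, Real.exp_le_exp]
  set u : ℝ := t ^ 2 * d ^ 2 with hu
  have htt : 1 ≤ t ^ 2 := one_le_pow₀ ht
  have hud : (d : ℝ) ≤ u := by nlinarith
  have hu1 : 1 ≤ u := hd1.trans hud
  have hR4 : R ≤ R ^ 4 := le_self_pow₀ hR (by norm_num)
  have hR41 : 1 ≤ R ^ 4 := hR.trans hR4
  have huℓ : u ≤ 2 * (u * ℓ) := by nlinarith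
  have hY : 0 ≤ u * ℓ := by positivity
  have e1 : 288 * ((Nat.log 2 d + 1 : ℕ) : ℝ) * t ^ 2 * d ^ 2 ≤ 1152 * (u * ℓ) := by
    calc 288 * ((Nat.log 2 d + 1 : ℕ) : ℝ) * t ^ 2 * d ^ 2
        = 288 * u * ((Nat.log 2 d + 1 : ℕ) : ℝ) := by rw [hu]; ring
      _ ≤ 288 * u * (4 * ℓ) := by gcongr
      _ = _ := by ring
  have e2 : (256 : ℝ) ≤ 512 * (u * ℓ) := by linarith
  have e3 : 30 * R * d ≤ 60 * R ^ 4 * (u * ℓ) := by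
    calc 30 * R * d ≤ 30 * R ^ 4 * (2 * (u * ℓ)) := by
          gcongr
          exact hud.trans huℓ
      _ = _ := by ring
  have e4 : u * ℓ ≤ R ^ 4 * (u * ℓ) := le_mul_of_one_le_left hY hR41
  have e5 : 29491200 * R ^ 4 * t ^ 2 * (d : ℝ) ^ 2 * ℓ = 29491200 * (R ^ 4 * (u * ℓ)) := by
    rw [hu]; ring
  rw [e5]
  linarith

theorem theorem4p9 (μ : Measure ℝ) [IsProbabilityMeasure μ] (hfin : FinitelySupported μ)
    (hmean : ∫ x, x ∂μ = 0) (hvar : variance (fun x : ℝ => x) μ = 1) :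
    ∃ C : ℝ, 0 < C ∧
      ∀ (n d : ℕ) (f : MvPolynomial (Fin n) ℝ) (t : ℝ),
        IsMultilinear f → f.totalDegree ≤ d →
        variance (fun x => MvPolynomial.eval x f) (productLaw μ n) = 1 →
        1 ≤ t →
        (∀ i, influence μ f i ≤ (t ^ 2)⁻¹ * (C ^ d)⁻¹) →
        Real.exp (-(C * t ^ 2 * (d : ℝ) ^ 2 * Real.log (max (d : ℝ) 2))) ≤
          (productLaw μ n).real {x | t ≤ |MvPolynomial.eval x f|} := by
  obtain ⟨s, m, hm, rfl⟩ := hfin.exists_map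
  set v : s → ℝ := Subtype.val with hv
  have hvm : AEMeasurable v m := Measurable.of_discrete.aemeasurable
  have hp1 : ∑ a, m.real {a} = 1 := by simp
  rw [variance_of_integral_eq_zero aemeasurable_id' hmean,
    integral_map hvm (by fun_prop), integral_fintype Integrable.of_finite] at hvar
  rw [integral_map hvm (by fun_prop), integral_fintype Integrable.of_finite] at hmean
  simp only [smul_eq_mul] at hvar hmean
  -- A crude bound on the support that is also at least 1.
  set R : ℝ := 1 + ∑ a, |v a| with hR
  have hR1 : 1 ≤ R := by
    have : 0 ≤ ∑ a, |v a| := Finset.sum_nonneg fun _ _ => abs_nonneg _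
    linarith
  have hvR : ∀ a, |v a| ≤ R := fun a => by
    have := Finset.single_le_sum (fun b _ => abs_nonneg (v b)) (Finset.mem_univ a)
    linarith
  refine ⟨29491200 * R ^ 4, by positivity, fun n d f t hf hd hfvar ht hinf => ?_⟩
  rw [hf.variance_eq hmean hvar] at hfvar
  have hc := MvPolynomial.setCoeff_eq_zero hd
  -- For d = 0 the polynomial is constant, contradicting unit variance.
  have hd1 : 1 ≤ d := by
    by_contra hd0
    rw [Finset.sum_eq_zero fun S hS => ?_] at hfvar
    · exact zero_ne_one hfvar
    · rw [hc S, zero_pow two_ne_zero]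
      have := Finset.card_pos.2 (Finset.nonempty_iff_ne_empty.2 (Finset.ne_of_mem_erase hS))
      omega
  simp only [hf.influence_eq hmean hvar] at hinf
  have hmeas : MeasurableSet {x : Fin n → ℝ | t ≤ |MvPolynomial.eval x f|} :=
    measurableSet_le measurable_const (MvPolynomial.continuous_eval f).measurable.abs
  rw [productLaw_map_real hmeas]
  refine (exp_neg_le_explicit_bound hR1 ht hd1).trans ?_
  have hmain := le_prodExp_abs_multilin_ge (ι := Fin n) (p := fun a => m.real {a}) (v := v)
    (fun _ => measureReal_nonneg) hp1 hmean hvar hR1 hvR hd1 hc hfvar ht hinf ?_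
  · refine hmain.trans (le_of_eq ?_)
    congr 2
    ext x
    simp only [Set.mem_ofPred_eq, ← hf.eval_eq v x]
  · have hd2 : (d : ℝ) ≤ 2 ^ d := by exact_mod_cast Nat.lt_two_pow_self.le
    -- The factor d⁴ is absorbed by d ≤ 2^d, which gives 29491200 = 73728 · 2⁴ · 5².
    have hC : 73728 * R ^ 2 * d ^ 4 * (5 * R) ^ (2 * d) ≤ (29491200 * R ^ 4) ^ d := by
      calc 73728 * R ^ 2 * d ^ 4 * (5 * R) ^ (2 * d)
          ≤ (73728 * R ^ 2) ^ d * ((2 : ℝ) ^ d) ^ 4 * (5 * R) ^ (2 * d) := by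
            gcongr
            exact le_self_pow₀ (by nlinarith) (by omega)
        _ = (73728 * R ^ 2 * 2 ^ 4 * (5 * R) ^ 2) ^ d := by
            rw [mul_pow (73728 * R ^ 2 * 2 ^ 4), mul_pow (73728 * R ^ 2), ← pow_mul, ← pow_mul,
              ← pow_mul, mul_comm d 4]
        _ = _ := by congr 1; ring
    have hCpos : 0 < (29491200 * R ^ 4) ^ d := by positivity
    rw [← mul_inv, inv_mul_le_iff₀ (by positivity), mul_one]
    calc 73728 * R ^ 2 * t ^ 2 * d ^ 4 * (5 * R) ^ (2 * d)
        = t ^ 2 * (73728 * R ^ 2 * d ^ 4 * (5 * R) ^ (2 * d)) := by ring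
      _ ≤ _ := by gcongr
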